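/- Let $\Gamma$ be a finite simplicial graph with vertex set $V$ and let $A_\Gamma=\langle V \mid [u,v]=1 \text{ for all adjacent } u,v\rangle$ be the associated right-angled Artin group. Let $\gamma_1(A_\Gamma)=A_\Gamma$ and $\gamma_{i+1}(A_\Gamma)=[\gamma_i(A_\Gamma),A_\Gamma]$ be the terms of its lower central series. For $c\ge 1$ let $G_c$ be the kernel of the natural map $\mathrm{Aut}(A_\Gamma)\to\mathrm{Aut}(A_\Gamma/\gamma_{c+1}(A_\Gamma))$, and let $H_c$ be the image of $G_c$ in $\mathrm{Out}(A_\Gamma)=\mathrm{Aut}(A_\Gamma)/\mathrm{Inn}(A_\Gamma)$. If the centre $Z(A_\Gamma)$ is trivial, then for every $c\ge 1$ the group $H_c/H_{c+1}$ is free abelian. -/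

import Mathlib

/-- The defining relators of the right-angled Artin group of `Γ`: the commutators `[u, v]`
of pairs of adjacent vertices. -/
def raagRelators {V : Type*} (Γ : SimpleGraph V) : Set (FreeGroup V) :=
  {r | ∃ u v : V, Γ.Adj u v ∧
    r = FreeGroup.of u * FreeGroup.of v * (FreeGroup.of u)⁻¹ * (FreeGroup.of v)⁻¹}

/-- The right-angled Artin group `A_Γ`. -/
abbrev RAAG {V : Type*} (Γ : SimpleGraph V) : Type _ :=
  PresentedGroup (raagRelators Γ)

section Aut

/-- The natural map `Aut(A) → Aut(A/K)` for a characteristic subgroup `K` of `A`,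
sending `φ` to the automorphism `gK ↦ φ(g)K`. -/
def autQuotient {A : Type*} [Group A] (K : Subgroup A) [hK : K.Characteristic] :
    MulAut A →* MulAut (A ⧸ K) where
  toFun φ := QuotientGroup.congr K K φ (Subgroup.characteristic_iff_map_eq.mp hK φ)
  map_one' := by
    ext x
    induction x using QuotientGroup.induction_on with
    | H g => rfl
  map_mul' φ ψ := by
    ext x
    induction x using QuotientGroup.induction_on with
    | H g => rfl

/-- The Andreadakis–Johnson term `G_c`: the kernel of `Aut(A) → Aut(A/γ_{c+1}(A))`, where
`γ_1(A) = A` and `γ_{i+1}(A) = [γ_i(A), A]`. Mathlib numbers the lower central series from `0`,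
so `γ_{c+1}(A)` is its term with index `c`. -/
def johnsonAut (A : Type*) [Group A] (c : ℕ) : Subgroup (MulAut A) :=
  (autQuotient ((⊤ : Subgroup A).lowerCentralSeries c)).ker

instance johnsonAut_normal (A : Type*) [Group A] (c : ℕ) : (johnsonAut A c).Normal := by
  unfold johnsonAut
  infer_instance

/-- The group `Inn(A)` of inner automorphisms. -/
def innerAut (A : Type*) [Group A] : Subgroup (MulAut A) :=
  (MulAut.conj : A →* MulAut A).range

instance innerAut_normal (A : Type*) [Group A] : (innerAut A).Normal where
  conj_mem := by
    rintro _ ⟨g, rfl⟩ φ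
    refine ⟨φ g, ?_⟩
    ext x
    simp [MulAut.conj_apply]

/-- The outer automorphism group `Out(A) = Aut(A)/Inn(A)`. -/
abbrev OuterAut (A : Type*) [Group A] : Type _ :=
  MulAut A ⧸ innerAut A

/-- `H_c`: the image of `G_c` under the projection `Aut(A) → Out(A)`. -/
def johnsonOut (A : Type*) [Group A] (c : ℕ) : Subgroup (OuterAut A) :=
  (johnsonAut A c).map (QuotientGroup.mk' (innerAut A))

instance johnsonOut_normal (A : Type*) [Group A] (c : ℕ) : (johnsonOut A c).Normal :=
  (johnsonAut_normal A c).map _ (QuotientGroup.mk'_surjective _)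

theorem mem_johnsonAut_iff {A : Type*} [Group A] {c : ℕ} {φ : MulAut A} :
    φ ∈ johnsonAut A c ↔ ∀ g : A, g⁻¹ * φ g ∈ (⊤ : Subgroup A).lowerCentralSeries c := by
  rw [johnsonAut, MonoidHom.mem_ker]
  constructor
  · intro h g
    have h1 := DFunLike.congr_fun h (g : A ⧸ (⊤ : Subgroup A).lowerCentralSeries c)
    exact QuotientGroup.eq.mp h1.symm
  · intro h
    ext x
    induction x using QuotientGroup.induction_on with
    | H g => exact (QuotientGroup.eq.mpr (h g)).symm

theorem johnsonOut_succ_le (A : Type*) [Group A] (c : ℕ) :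
    johnsonOut A (c + 1) ≤ johnsonOut A c :=
  Subgroup.map_mono fun _ hφ => mem_johnsonAut_iff.mpr fun g =>
    Subgroup.lowerCentralSeries_antitone _ (Nat.le_succ c) (mem_johnsonAut_iff.mp hφ g)

/-- The quotient group `H_c / H_{c+1}` (note `johnsonOut_succ_le`). -/
abbrev JohnsonOutQuotient (A : Type*) [Group A] (c : ℕ) : Type _ :=
  johnsonOut A c ⧸ (johnsonOut A (c + 1)).subgroupOf (johnsonOut A c)

end Aut

/-- A group is free abelian if it is isomorphic to the free abelian group on some set.
(A basis can be taken inside `G`, so nothing is lost by fixing the universe.) -/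
def IsFreeAbelian.{u} (G : Type u) [Group G] : Prop :=
  ∃ X : Type u, Nonempty (G ≃* Multiplicative (FreeAbelianGroup X))

/-!
Write `γ n` for the terms of the lower central series of `A = A_Γ`, numbered from `0`, and
`gr A = ⨁ γ n / γ (n + 1)` for the graded Lie ring. For `c = d + 1` the Johnson homomorphism
`φ ↦ (v ↦ v⁻¹ φ(v))` maps `G_c` to the finitely generated abelian group of functions from `V` to
`gr_c A`, with kernel `G_{c+1}`. Hence `H_c / H_{c+1}` is a finitely generated abelian group, and it
is free once it has no `p`-torsion for any prime `p`.

Suppose `φ ∈ G_c` and `φ ^ p = ψ ∘ conj g` with `ψ ∈ G_{c+1}`. Three facts about `gr A` are needed: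
* it is torsion-free (`mem_lcs_succ_of_pow`);
* its centre is trivial (`mem_lcs_succ_of_commutator`), which forces `g ∈ γ d`;
* the centre of `gr A ⊗ 𝔽_p` is trivial (`exists_pow_of_commutator`). As `[g, v]` is a `p`-th power
  modulo `γ (c + 1)` for every vertex `v`, so is `g` modulo `γ (d + 1)`; say `g ≡ h ^ p`.

Then the Johnson images of `φ` and `conj h` agree up to `p`-torsion, hence agree, and `φ` is trivial
in `H_c / H_{c+1}` (`eq_one_of_pow_eq_one`).

The three facts are read off in the algebra `k[M]` of the trace monoid `M` of `Γ`, in which adjacent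
letters commute. The Magnus homomorphism sends `v` to `1 + v X` in `k[M]⟦X⟧`; for `x ∈ γ n` its value
is `1 + a X ^ (n + 1) + ⋯`, and group commutators go to ring commutators of leading coefficients.
If no vertex is adjacent to all others, an element of `k[M]` without constant term that commutes
with all letters vanishes (`TraceMonoid.eq_zero_of_commute`). What remains is that `x` is determined
by `a`: if `a = 0` in `𝔽_p[M]`, then `x` is a `p`-th power modulo `γ (n + 1)`
(`exists_nsmul_of_hasLead_zero`). For this let `U` be the enveloping algebra of `gr A ⊗ 𝔽_p`,
truncated above degree `n`. Generators of adjacent vertices commute in `U`, so there is a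
homomorphism `𝔽_p[M] → U`, and it maps `a` to the image of the class of `x`. The truncated Lie
algebra is finite-dimensional and solvable, so it embeds in `U`
(`UniversalEnvelopingAlgebra.ι_injective_of_isSolvable`), a case of the Poincaré–Birkhoff–Witt
theorem with a short proof by induction on the dimension. The integral statement
(`mem_lcs_succ_of_hasLead_zero`) follows for all primes together: the classes in `gr_n A` with
vanishing integral leading coefficient form a finitely generated divisible group.
-/

/-! ### Enveloping algebras of solvable Lie algebras -/

section Enveloping

open UniversalEnvelopingAlgebra

attribute [local instance] LieRing.ofAssociativeRing

/-- A derivation of a Lie algebra extends to a derivation of its enveloping algebra `U`: it is the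
`ε`-part of the homomorphism from `U` to the dual numbers `U[ε]` with `ι x ↦ ι x + ε ι (d x)`. -/
theorem UniversalEnvelopingAlgebra.exists_linearMap_leibniz {k L : Type*} [CommRing k] [LieRing L]
    [LieAlgebra k L] (d : LieDerivation k L L) :
    ∃ D : UniversalEnvelopingAlgebra k L →ₗ[k] UniversalEnvelopingAlgebra k L,
      (∀ a b, D (a * b) = a * D b + D a * b) ∧ ∀ x, D (ι k x) = ι k (d x) := by
  let U := UniversalEnvelopingAlgebra k L
  let φ : L →ₗ⁅k⁆ TrivSqZeroExt U U :=
    { toFun := fun x => TrivSqZeroExt.inl (ι k x) + TrivSqZeroExt.inr (ι k (d x))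
      map_add' := fun x y => by ext <;> simp
      map_smul' := fun r x => by ext <;> simp
      map_lie' := fun {x y} => by
        ext
        · simp [LieRing.of_associative_ring_bracket, -ι_apply]
        · simp [LieRing.of_associative_ring_bracket, -ι_apply]
          abel }
  let Φ := lift k φ
  have hΦ : ∀ x, Φ (ι k x) = φ x := lift_ι_apply k φ
  have hfst : (TrivSqZeroExt.fstHom k U U).comp Φ = AlgHom.id k U := by
    ext x
    change (Φ (ι k x)).fst = ι k x
    simp [hΦ, φ, -ι_apply]
  have hfst' : ∀ a, (Φ a).fst = a := fun a => DFunLike.congr_fun hfst a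
  refine ⟨(TrivSqZeroExt.sndHom U U).restrictScalars k ∘ₗ Φ.toLinearMap, fun a b => ?_, fun x => ?_⟩
  · simp [hfst']
  · change (Φ (ι k x)).snd = _
    simp [hΦ, φ, -ι_apply]

/-- A finite-dimensional solvable Lie algebra `L` embeds in its enveloping algebra. Pick a nonzero
linear form `f` vanishing on brackets, `x` with `f x = 1`, and let `H = ker f`. Then `L` acts on the
enveloping algebra of `H`: elements of `H` act by left multiplication and `x` acts by the derivation
extending `[x, ·]`. This action is faithful on `H` by induction, and `f` detects the rest. -/
theorem UniversalEnvelopingAlgebra.ι_injective_of_isSolvable {k : Type*} [Field k] (L : Type*)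
    [LieRing L] [LieAlgebra k L] [FiniteDimensional k L] [LieAlgebra.IsSolvable L] :
    Function.Injective (ι k : L → UniversalEnvelopingAlgebra k L) := by
  induction hn : Module.finrank k L using Nat.strong_induction_on generalizing L with
  | _ n ih =>
  rcases subsingleton_or_nontrivial L with hL | hL
  · exact Function.injective_of_subsingleton _
  obtain ⟨f, hf0, hf⟩ := Submodule.exists_le_ker_of_lt_top
    (LieAlgebra.derivedSeries k L 1).toSubmodule
    (lt_top_iff_ne_top.mpr fun h => (LieAlgebra.derivedSeries_lt_top_of_solvable k L).ne
      (LieSubmodule.toSubmodule_injective (by simpa using h)))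
  have hflie : ∀ x y : L, f ⁅x, y⁆ = 0 := fun x y => hf (by
    rw [LieAlgebra.derivedSeries_def, LieAlgebra.derivedSeriesOfIdeal_succ]
    exact LieSubmodule.lie_mem_lie (LieSubmodule.mem_top _) (LieSubmodule.mem_top _))
  obtain ⟨x, hx⟩ : ∃ x, f x = 1 := by
    obtain ⟨y, hy⟩ : ∃ y, f y ≠ 0 := by
      by_contra! h
      exact hf0 (LinearMap.ext h)
    exact ⟨(f y)⁻¹ • y, by simp [hy]⟩
  let H : LieIdeal k L :=
    { f.ker with lie_mem := fun {a m} _ => hflie a m }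
  have hH : ∀ y, y ∈ H ↔ f y = 0 := fun y => Iff.rfl
  have hlt : Module.finrank k H < n := by
    rw [← hn]
    refine Submodule.finrank_lt (s := H.toSubmodule) fun h => ?_
    have : x ∈ H.toSubmodule := h ▸ Submodule.mem_top
    exact one_ne_zero (hx.symm.trans ((hH x).mp this))
  have hι := ih _ hlt H rfl
  let d : LieDerivation k H H :=
    { toFun := fun h => ⟨⁅x, (h : L)⁆, hflie _ _⟩
      map_add' := fun a b => by ext; simp
      map_smul' := fun r a => by ext; simp
      leibniz' := fun a b => by
        ext
        have := leibniz_lie x (a : L) (b : L)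
        have h2 := lie_skew (b : L) ⁅x, (a : L)⁆
        simp only [LinearMap.coe_mk, AddHom.coe_mk, LieSubmodule.coe_sub, LieSubmodule.coe_bracket,
          LieIdeal.coe_bracket_of_module]
        rw [← h2, this]
        abel }
  obtain ⟨D, hD, hDι⟩ := exists_linearMap_leibniz d
  -- the projection onto `H` along `x`
  let pr : L →ₗ[k] H :=
    { toFun := fun y => ⟨y - f y • x, by simp [hH, hx]⟩
      map_add' := fun a b => by ext; simp [add_smul]; abel
      map_smul' := fun r a => by ext; simp [smul_sub, smul_smul] }
  let ρ : L →ₗ⁅k⁆ Module.End k (UniversalEnvelopingAlgebra k H) :=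
    { toFun := fun y => f y • D + LinearMap.mulLeft k (ι k (pr y))
      map_add' := fun a b => by ext; simp [add_smul, add_mul, -ι_apply]; abel
      map_smul' := fun r a => by ext; simp [smul_smul, -ι_apply]
      map_lie' := fun {a b} => by
        -- both sides reduce to `[D, ι y] = ι (d y)` because brackets lie in `ker f`
        have hpr : pr ⁅a, b⁆ = f a • d (pr b) - f b • d (pr a) + ⁅pr a, pr b⁆ := by
          ext
          simp [pr, d, hflie]
          rw [← lie_skew x a]
          module
        ext u
        simp only [hflie, hpr, LieRing.of_associative_ring_bracket, zero_smul, zero_add,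
          LinearMap.mulLeft_apply, LinearMap.add_apply, LinearMap.sub_apply, LinearMap.smul_apply,
          Module.End.mul_apply, map_add, map_sub, map_smul, LieHom.map_lie, hD, hDι, add_mul,
          sub_mul, smul_mul_assoc, smul_add, mul_assoc, mul_add, mul_smul_comm,
          smul_comm (f b) (f a)]
        abel }
  rw [injective_iff_map_eq_zero]
  intro y hy
  have hρ : ρ y = 0 := by rw [← lift_ι_apply k ρ, hy, map_zero]
  have hfy : f y = 0 := by
    let χ : L →ₗ⁅k⁆ k := { f with
      map_lie' := fun {a b} => by
        simpa [LieRing.of_associative_ring_bracket, mul_comm] using hflie a b }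
    have : χ y = 0 := by rw [← lift_ι_apply k χ, hy, map_zero]
    exact this
  have h1 := DFunLike.congr_fun hρ 1
  have h2 : ι k (pr y) = 0 := by simpa [ρ, hfy, -ι_apply] using h1
  have h3 := hι (h2.trans (map_zero _).symm)
  have h4 := congrArg Subtype.val h3
  simpa [pr, hfy] using h4

end Enveloping

/-! ### Graded Lie rings of the lower central series -/

section LowerCentral

open scoped commutatorElement DirectSum

variable {G : Type*} [Group G]

/-- The lower central series of a group, numbered from `0`: `lcs G n` is `γ_{n+1}(G)` in the usual
numbering. The commutator of degrees `m` and `n` therefore has degree `m + n + 1`. -/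
abbrev lcs (G : Type*) [Group G] (n : ℕ) : Subgroup G :=
  (⊤ : Subgroup G).lowerCentralSeries n

/-- The three subgroups lemma gives the inductive step, applied in the quotient by the right side. -/
theorem commutator_lcs_le (m n : ℕ) : ⁅lcs G m, lcs G n⁆ ≤ lcs G (m + n + 1) := by
  induction n generalizing m with
  | zero => exact le_rfl
  | succ n ih =>
    have h1 : ⁅⁅(⊤ : Subgroup G), lcs G m⁆, lcs G n⁆ ≤ lcs G (m + (n + 1) + 1) := by
      rw [Subgroup.commutator_comm ⊤]
      exact (ih (m + 1)).trans_eq (by congr 1; omega)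
    have h2 : ⁅⁅lcs G m, lcs G n⁆, (⊤ : Subgroup G)⁆ ≤ lcs G (m + (n + 1) + 1) :=
      Subgroup.commutator_mono (ih m) le_rfl
    rw [← QuotientGroup.ker_mk' (lcs G (m + (n + 1) + 1)), ← Subgroup.map_eq_bot_iff] at h1 h2 ⊢
    rw [Subgroup.map_commutator] at h1 h2 ⊢
    rw [Subgroup.map_commutator] at h1 h2
    rw [Subgroup.commutator_comm]
    change ⁅Subgroup.map _ ⁅lcs G n, ⊤⁆, _⁆ = ⊥
    rw [Subgroup.map_commutator]
    exact Subgroup.commutator_commutator_eq_bot_of_rotate h1 h2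

theorem lcs_anti {m n : ℕ} (h : m ≤ n) : lcs G n ≤ lcs G m :=
  Subgroup.lowerCentralSeries_antitone _ h

theorem commutatorElement_mem_lcs {m n : ℕ} {x y : G} (hx : x ∈ lcs G m) (hy : y ∈ lcs G n) :
    ⁅x, y⁆ ∈ lcs G (m + n + 1) :=
  commutator_lcs_le m n (Subgroup.commutator_mem_commutator hx hy)

theorem lcs_succ_induction {n : ℕ} {p : G → Prop} (comm : ∀ x ∈ lcs G n, ∀ g, p ⁅x, g⁆)
    (one : p 1) (mul : ∀ x ∈ lcs G (n + 1), ∀ y ∈ lcs G (n + 1), p x → p y → p (x * y))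
    (inv : ∀ x ∈ lcs G (n + 1), p x → p x⁻¹) : ∀ x ∈ lcs G (n + 1), p x := by
  intro x hx
  refine Subgroup.closure_induction (p := fun x _ => p x) ?_ one
    (fun x y hx hy => mul x hx y hy) (fun x hx => inv x hx) hx
  rintro _ ⟨a, ha, g, -, rfl⟩
  exact comm a ha g

/-- Subgroups `E n` such that the quotients `lcs G n / E n` inherit the structure of a graded Lie
ring from the commutators of `G`. The choice `E n = lcs G (n + 1)` gives the Lie ring of the lower
central series; larger `E n` give quotients of it, such as reductions modulo a prime. -/
structure LCSQuotients (G : Type*) [Group G] where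
  /-- The subgroup divided out in degree `n`. -/
  E : ℕ → Subgroup G
  normal : ∀ n, (E n).Normal
  succ_le : ∀ n, lcs G (n + 1) ≤ E n
  comm_mem : ∀ m n, ∀ x ∈ E m, x ∈ lcs G m → ∀ y ∈ lcs G n, ⁅x, y⁆ ∈ E (m + n + 1)

namespace LCSQuotients

variable (S : LCSQuotients G)

instance (n : ℕ) : (S.E n).Normal := S.normal n

theorem commutator_mem {n : ℕ} {x : G} (hx : x ∈ lcs G n) (g : G) : ⁅x, g⁆ ∈ S.E n :=
  S.succ_le n (Subgroup.commutator_mem_commutator hx (Subgroup.mem_top g))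

/-- The component of degree `n`: the quotient of `lcs G n` by its intersection with `E n`, written
additively. -/
def Gr (n : ℕ) : Type _ := Additive (lcs G n ⧸ (S.E n).subgroupOf (lcs G n))

instance (n : ℕ) : AddCommGroup (S.Gr n) :=
  { (inferInstance : AddGroup (Additive (lcs G n ⧸ (S.E n).subgroupOf (lcs G n)))) with
    add_comm := by
      rintro ⟨⟨x, hx⟩⟩ ⟨⟨y, hy⟩⟩
      refine QuotientGroup.eq.mpr ?_
      rw [Subgroup.mem_subgroupOf]
      have := S.commutator_mem (inv_mem hy) x⁻¹
      simpa [commutatorElement_def, mul_assoc] using this }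

/-- The class in degree `n` of an element of `lcs G n`. -/
def cls (n : ℕ) (x : G) (hx : x ∈ lcs G n) : S.Gr n :=
  Additive.ofMul (QuotientGroup.mk (⟨x, hx⟩ : lcs G n))

variable {S}

theorem cls_surjective {n : ℕ} (a : S.Gr n) : ∃ x hx, S.cls n x hx = a := by
  obtain ⟨⟨x, hx⟩⟩ := a
  exact ⟨x, hx, rfl⟩

theorem cls_eq_iff {n : ℕ} {x y : G} {hx : x ∈ lcs G n} {hy : y ∈ lcs G n} :
    S.cls n x hx = S.cls n y hy ↔ x⁻¹ * y ∈ S.E n :=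
  QuotientGroup.eq

theorem cls_mul {n : ℕ} {x y : G} (hx : x ∈ lcs G n) (hy : y ∈ lcs G n) :
    S.cls n (x * y) (mul_mem hx hy) = S.cls n x hx + S.cls n y hy := rfl

theorem cls_inv {n : ℕ} {x : G} (hx : x ∈ lcs G n) :
    S.cls n x⁻¹ (inv_mem hx) = - S.cls n x hx := rfl

theorem cls_one {n : ℕ} : S.cls n 1 (one_mem _) = 0 := rfl

theorem cls_eq_zero_iff {n : ℕ} {x : G} {hx : x ∈ lcs G n} : S.cls n x hx = 0 ↔ x ∈ S.E n := by
  rw [← cls_one, eq_comm, cls_eq_iff]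
  simp

theorem cls_pow {n : ℕ} {x : G} (hx : x ∈ lcs G n) (k : ℕ) :
    S.cls n (x ^ k) (pow_mem hx k) = k • S.cls n x hx := rfl

theorem cls_congr {n : ℕ} {x y : G} {hx : x ∈ lcs G n} (h : x = y) :
    S.cls n x hx = S.cls n y (h ▸ hx) := by subst h; rfl

theorem cls_conj {n : ℕ} {x : G} (g : G) (hx : x ∈ lcs G n) {hx' : g * x * g⁻¹ ∈ lcs G n} :
    S.cls n (g * x * g⁻¹) hx' = S.cls n x hx := by
  rw [eq_comm, cls_eq_iff]
  have := S.commutator_mem (inv_mem hx) g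
  simpa [commutatorElement_def, mul_assoc] using this

theorem cls_commutator_mul_left {m n : ℕ} {x x' y : G} (hx : x ∈ lcs G m) (hx' : x' ∈ lcs G m)
    (hy : y ∈ lcs G n) :
    S.cls (m + n + 1) ⁅x * x', y⁆ (commutatorElement_mem_lcs (mul_mem hx hx') hy) =
      S.cls (m + n + 1) ⁅x, y⁆ (commutatorElement_mem_lcs hx hy) +
      S.cls (m + n + 1) ⁅x', y⁆ (commutatorElement_mem_lcs hx' hy) := by
  have h := commutatorElement_mem_lcs hx' hy
  rw [cls_congr (commutatorElement_mul_left_eq_conj_mul x x' y),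
    cls_mul ((inferInstance : (lcs G _).Normal).conj_mem _ h x) (commutatorElement_mem_lcs hx hy),
    cls_conj x h]
  exact add_comm _ _

theorem cls_commutator_mul_right {m n : ℕ} {x y y' : G} (hx : x ∈ lcs G m) (hy : y ∈ lcs G n)
    (hy' : y' ∈ lcs G n) :
    S.cls (m + n + 1) ⁅x, y * y'⁆ (commutatorElement_mem_lcs hx (mul_mem hy hy')) =
      S.cls (m + n + 1) ⁅x, y⁆ (commutatorElement_mem_lcs hx hy) +
      S.cls (m + n + 1) ⁅x, y'⁆ (commutatorElement_mem_lcs hx hy') := by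
  have h := commutatorElement_mem_lcs hx hy'
  have h1 := commutatorElement_mem_lcs hx hy
  rw [cls_congr ((commutatorElement_mul_right_eq_mul_conj x y y').trans
      (by simp only [mul_assoc] : _ = ⁅x, y⁆ * (y * ⁅x, y'⁆ * y⁻¹))),
    cls_mul h1 ((inferInstance : (lcs G _).Normal).conj_mem _ h y), cls_conj y h]

theorem cls_commutator_congr {m n : ℕ} {x x' y y' : G} (hx : x ∈ lcs G m) (hx' : x' ∈ lcs G m)
    (hy : y ∈ lcs G n) (hy' : y' ∈ lcs G n) (hxx : S.cls m x hx = S.cls m x' hx')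
    (hyy : S.cls n y hy = S.cls n y' hy') :
    S.cls (m + n + 1) ⁅x, y⁆ (commutatorElement_mem_lcs hx hy) =
      S.cls (m + n + 1) ⁅x', y'⁆ (commutatorElement_mem_lcs hx' hy') := by
  rw [cls_eq_iff] at hxx hyy
  have hex : x⁻¹ * x' ∈ lcs G m := mul_mem (inv_mem hx) hx'
  have hey : y⁻¹ * y' ∈ lcs G n := mul_mem (inv_mem hy) hy'
  have h1 : S.cls (m + n + 1) ⁅x, y⁆ (commutatorElement_mem_lcs hx hy) =
      S.cls (m + n + 1) ⁅x', y⁆ (commutatorElement_mem_lcs hx' hy) := by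
    have e : ⁅x', y⁆ = ⁅x * (x⁻¹ * x'), y⁆ := by simp
    rw [cls_congr (hx := commutatorElement_mem_lcs hx' hy) e,
      cls_commutator_mul_left hx hex hy, left_eq_add, cls_eq_zero_iff]
    exact S.comm_mem m n _ hxx hex y hy
  have e : ⁅x', y'⁆ = ⁅x', y * (y⁻¹ * y')⁆ := by simp
  rw [h1, cls_congr (hx := commutatorElement_mem_lcs hx' hy') e,
    cls_commutator_mul_right hx' hy hey, left_eq_add, cls_eq_zero_iff,
    ← commutatorElement_inv, inv_mem_iff]
  have := S.comm_mem n m _ hyy hey x' hx'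
  rwa [add_comm n m] at this

variable (S)

theorem exists_lieHom (m n : ℕ) : ∃ f : S.Gr m →+ S.Gr n →+ S.Gr (m + n + 1),
    ∀ x hx y hy, f (S.cls m x hx) (S.cls n y hy) =
      S.cls (m + n + 1) ⁅x, y⁆ (commutatorElement_mem_lcs hx hy) := by
  choose r hr hr' using fun a : S.Gr m => cls_surjective a
  choose t ht ht' using fun a : S.Gr n => cls_surjective a
  let b : S.Gr m → S.Gr n → S.Gr (m + n + 1) := fun a c =>
    S.cls (m + n + 1) ⁅r a, t c⁆ (commutatorElement_mem_lcs (hr a) (ht c))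
  have hb : ∀ x hx y hy, b (S.cls m x hx) (S.cls n y hy) =
      S.cls (m + n + 1) ⁅x, y⁆ (commutatorElement_mem_lcs hx hy) := fun x hx y hy =>
    cls_commutator_congr _ hx _ hy (hr' _) (ht' _)
  refine ⟨AddMonoidHom.mk' (fun a => AddMonoidHom.mk' (b a) ?_) ?_, hb⟩
  · intro c c'
    obtain ⟨x, hx, rfl⟩ := cls_surjective a
    obtain ⟨y, hy, rfl⟩ := cls_surjective c
    obtain ⟨y', hy', rfl⟩ := cls_surjective c'
    rw [← cls_mul, hb, hb, hb, cls_commutator_mul_right hx hy hy']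
  · intro a a'
    ext c
    obtain ⟨x, hx, rfl⟩ := cls_surjective a
    obtain ⟨x', hx', rfl⟩ := cls_surjective a'
    obtain ⟨y, hy, rfl⟩ := cls_surjective c
    change b _ _ = b _ _ + b _ _
    rw [← cls_mul, hb, hb, hb, cls_commutator_mul_left hx hx' hy]

/-- The Lie bracket on homogeneous components, induced by the commutator of group elements. -/
noncomputable def lieHom (m n : ℕ) : S.Gr m →+ S.Gr n →+ S.Gr (m + n + 1) :=
  (S.exists_lieHom m n).choose

theorem lieHom_cls {m n : ℕ} {x y : G} (hx : x ∈ lcs G m) (hy : y ∈ lcs G n) :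
    S.lieHom m n (S.cls m x hx) (S.cls n y hy) =
      S.cls (m + n + 1) ⁅x, y⁆ (commutatorElement_mem_lcs hx hy) :=
  (S.exists_lieHom m n).choose_spec x hx y hy

/-- The graded Lie ring `⨁ n, lcs G n / E n`. The bracket of components of degrees `m` and `n`
lies in degree `m + n + 1`. -/
def Total : Type _ := ⨁ n, S.Gr n

noncomputable instance : AddCommGroup S.Total := inferInstanceAs (AddCommGroup (⨁ n, S.Gr n))

/-- The inclusion of a homogeneous component. -/
noncomputable def of (n : ℕ) : S.Gr n →+ S.Total := DirectSum.of S.Gr n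

/-- The homogeneous element of the graded Lie ring given by an element of `lcs G n`. -/
noncomputable def hcls (n : ℕ) (x : G) (hx : x ∈ lcs G n) : S.Total := S.of n (S.cls n x hx)

/-- The Lie bracket as a biadditive map. -/
noncomputable def brHom : S.Total →+ S.Total →+ S.Total :=
  DirectSum.toAddMonoid fun m => AddMonoidHom.flip <|
    DirectSum.toAddMonoid fun n => AddMonoidHom.flip <|
      (S.of (m + n + 1)).compHom.comp (S.lieHom m n)

variable {S}

theorem of_injective (n : ℕ) : Function.Injective (S.of n) := DirectSum.of_injective n

theorem hcls_congr {m n : ℕ} {x y : G} {hx : x ∈ lcs G m} {hy : y ∈ lcs G n} (hmn : m = n)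
    (h : x = y) : S.hcls m x hx = S.hcls n y hy := by
  subst hmn h; rfl

theorem brHom_hcls {m n : ℕ} {x y : G} (hx : x ∈ lcs G m) (hy : y ∈ lcs G n) :
    S.brHom (S.hcls m x hx) (S.hcls n y hy) =
      S.hcls (m + n + 1) ⁅x, y⁆ (commutatorElement_mem_lcs hx hy) := by
  unfold hcls
  rw [← lieHom_cls _ hx hy]
  exact (DFunLike.congr_fun (DirectSum.toAddMonoid_of _ m (S.cls m x hx)) _).trans
    (DFunLike.congr_fun (DirectSum.toAddMonoid_of
      (fun n => ((S.of (m + n + 1)).compHom.comp (S.lieHom m n)).flip) n (S.cls n y hy)) _)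

theorem total_induction {p : S.Total → Prop} (hom : ∀ n x hx, p (S.hcls n x hx))
    (add : ∀ a b, p a → p b → p (a + b)) (a : S.Total) : p a := by
  refine DirectSum.induction_on (motive := p) a ?_ ?_ add
  · have := hom 0 1 (one_mem _)
    rwa [hcls, cls_one, map_zero] at this
  · intro n c
    obtain ⟨x, hx, rfl⟩ := cls_surjective c
    exact hom n x hx

theorem hcls_mul {n : ℕ} {x y : G} (hx : x ∈ lcs G n) (hy : y ∈ lcs G n) :
    S.hcls n (x * y) (mul_mem hx hy) = S.hcls n x hx + S.hcls n y hy := by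
  simp [hcls, cls_mul hx hy]

theorem hcls_inv {n : ℕ} {x : G} (hx : x ∈ lcs G n) :
    S.hcls n x⁻¹ (inv_mem hx) = - S.hcls n x hx := by
  simp [hcls, cls_inv hx]

theorem hcls_one {n : ℕ} : S.hcls n 1 (one_mem _) = 0 := by
  simp [hcls, cls_one]

theorem hcls_conj {n : ℕ} {x : G} (g : G) (hx : x ∈ lcs G n) {hx' : g * x * g⁻¹ ∈ lcs G n} :
    S.hcls n (g * x * g⁻¹) hx' = S.hcls n x hx := by
  simp [hcls, cls_conj g hx]

theorem brHom_skew (a b : S.Total) : S.brHom b a = - S.brHom a b := by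
  induction a using total_induction with
  | add a a' h h' => simp [h, h', add_comm]
  | hom m x hx =>
    induction b using total_induction with
    | add b b' h h' => simp [h, h', add_comm]
    | hom n y hy =>
      rw [brHom_hcls, brHom_hcls, ← hcls_inv]
      exact hcls_congr (by omega) (commutatorElement_inv x y).symm

theorem brHom_self (a : S.Total) : S.brHom a a = 0 := by
  induction a using total_induction with
  | add a a' h h' => simp [h, h', brHom_skew a a']
  | hom m x hx =>
    rw [brHom_hcls, ← hcls_one (n := m + m + 1)]
    exact hcls_congr rfl (commutatorElement_self x)

/-- On homogeneous elements this is the Hall–Witt identity, since classes are invariant under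
conjugation. -/
theorem brHom_jacobi (a b c : S.Total) : S.brHom (S.brHom a b) c + S.brHom (S.brHom b c) a +
    S.brHom (S.brHom c a) b = 0 := by
  induction a using total_induction with
  | add a a' h h' =>
    simp only [map_add, AddMonoidHom.add_apply]
    rw [← add_zero (0 : S.Total)]
    nth_rw 1 [← h]
    rw [← h']
    abel
  | hom m x hx =>
  induction b using total_induction with
  | add b b' h h' =>
    simp only [map_add, AddMonoidHom.add_apply]
    rw [← add_zero (0 : S.Total)]
    nth_rw 1 [← h]
    rw [← h']
    abel
  | hom n y hy =>
  induction c using total_induction with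
  | add c c' h h' =>
    simp only [map_add, AddMonoidHom.add_apply]
    rw [← add_zero (0 : S.Total)]
    nth_rw 1 [← h]
    rw [← h']
    abel
  | hom k z hz =>
    have conj {i : ℕ} {u : G} (hu : u ∈ lcs G i) (g : G) : g * u * g⁻¹ ∈ lcs G i :=
      (inferInstance : (lcs G i).Normal).conj_mem _ hu g
    -- replace the outer entries by the conjugates occurring in the Hall–Witt identity
    nth_rw 1 [← hcls_conj y hz (hx' := conj hz y)]
    nth_rw 2 [← hcls_conj z hx (hx' := conj hx z)]
    nth_rw 3 [← hcls_conj x hy (hx' := conj hy x)]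
    simp only [brHom_hcls]
    have h1 := commutatorElement_mem_lcs (commutatorElement_mem_lcs hx hy) (conj hz y)
    have h2 := commutatorElement_mem_lcs (commutatorElement_mem_lcs hy hz) (conj hx z)
    have h3 := commutatorElement_mem_lcs (commutatorElement_mem_lcs hz hx) (conj hy x)
    have e2 : n + k + 1 + m + 1 = m + n + 1 + k + 1 := by omega
    have e3 : k + m + 1 + n + 1 = m + n + 1 + k + 1 := by omega
    rw [hcls_congr (hx := h2) (hy := e2 ▸ h2) e2 rfl, hcls_congr (hx := h3) (hy := e3 ▸ h3) e3 rfl,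
      ← hcls_mul h1 (e2 ▸ h2), ← hcls_mul (mul_mem h1 (e2 ▸ h2)) (e3 ▸ h3), ← hcls_one]
    exact hcls_congr rfl (commutatorElement_commutatorElement_conj_mul x y z)

noncomputable instance : LieRing S.Total where
  bracket a b := S.brHom a b
  add_lie _ _ _ := by simp
  lie_add _ _ _ := by simp
  lie_self := brHom_self
  leibniz_lie a b c := by
    change S.brHom a (S.brHom b c) = S.brHom (S.brHom a b) c + S.brHom b (S.brHom a c)
    have h := brHom_jacobi a b c
    rw [brHom_skew a (S.brHom b c), brHom_skew b (S.brHom c a), brHom_skew a c, map_neg] at h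
    rw [← sub_eq_zero, ← neg_eq_zero, ← h]
    abel

theorem lie_hcls {m n : ℕ} {x y : G} (hx : x ∈ lcs G m) (hy : y ∈ lcs G n) :
    ⁅S.hcls m x hx, S.hcls n y hy⁆ =
      S.hcls (m + n + 1) ⁅x, y⁆ (commutatorElement_mem_lcs hx hy) :=
  brHom_hcls hx hy

end LCSQuotients
end LowerCentral

/-! ### The graded Lie algebra modulo a prime -/

section ModP

open scoped commutatorElement DirectSum

variable {G : Type*} [Group G]

namespace LCSQuotients

variable (S : LCSQuotients G)

/-- The graded Lie ring is generated in degree `0`. -/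
theorem gr_succ_le_span (n : ℕ) (a : S.Gr (n + 1)) :
    a ∈ AddSubgroup.closure {d | ∃ b : S.Gr n, ∃ c : S.Gr 0, S.lieHom n 0 b c = d} := by
  obtain ⟨x, hx, rfl⟩ := cls_surjective a
  suffices h : ∀ x ∈ lcs G (n + 1), ∃ hx : x ∈ lcs G (n + 1), S.cls (n + 1) x hx ∈
      AddSubgroup.closure {d | ∃ b : S.Gr n, ∃ c : S.Gr 0, S.lieHom n 0 b c = d} from (h x hx).2
  apply lcs_succ_induction
  · intro x hx g
    have hg : g ∈ lcs G 0 := Subgroup.mem_top g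
    have h : ⁅x, g⁆ ∈ lcs G (n + 1) := Subgroup.commutator_mem_commutator hx hg
    have h' : S.lieHom n 0 (S.cls n x hx) (S.cls 0 g hg) = S.cls (n + 1) ⁅x, g⁆ h :=
      S.lieHom_cls hx hg
    exact ⟨h, AddSubgroup.subset_closure ⟨S.cls n x hx, S.cls 0 g hg, h'⟩⟩
  · exact ⟨one_mem _, zero_mem _⟩
  · rintro x - y - ⟨hx, hx'⟩ ⟨hy, hy'⟩
    exact ⟨mul_mem hx hy, add_mem hx' hy'⟩
  · rintro x - ⟨hx, hx'⟩
    exact ⟨inv_mem hx, neg_mem hx'⟩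

theorem gr_zero_finite [Group.FG G] : Module.Finite ℤ (S.Gr 0) := by
  let f : Additive G →+ S.Gr 0 :=
    AddMonoidHom.mk' (fun g => S.cls 0 g.toMul (Subgroup.mem_top _)) fun _ _ => rfl
  have hf : Function.Surjective f := fun a => by
    obtain ⟨x, hx, rfl⟩ := cls_surjective a
    exact ⟨Additive.ofMul x, rfl⟩
  exact Module.Finite.iff_addGroup_fg.mpr (AddGroup.fg_of_surjective hf)

instance gr_finite [Group.FG G] (n : ℕ) : Module.Finite ℤ (S.Gr n) := by
  induction n with
  | zero => exact S.gr_zero_finite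
  | succ n ih =>
    let f : S.Gr n →ₗ[ℤ] S.Gr 0 →ₗ[ℤ] S.Gr (n + 1) :=
      LinearMap.mk₂ ℤ (fun a b => S.lieHom n 0 a b) (by simp) (by simp) (by simp) (by simp)
    refine ⟨?_⟩
    have h : Submodule.map₂ f ⊤ ⊤ = ⊤ := by
      rw [eq_top_iff]
      intro a _
      refine (AddSubgroup.closure_le (K := (Submodule.map₂ f ⊤ ⊤).toAddSubgroup)).mpr ?_
        (S.gr_succ_le_span n a)
      rintro _ ⟨b, c, rfl⟩
      exact Submodule.apply_mem_map₂ f Submodule.mem_top Submodule.mem_top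
    rw [← h]
    exact Submodule.FG.map₂ f Module.Finite.fg_top S.gr_zero_finite.fg_top

theorem total_finite [Group.FG G] {c : ℕ} (hc : ∀ n, c < n → S.E n = lcs G n) :
    Module.Finite ℤ S.Total := by
  let f : (Π i : Fin (c + 1), S.Gr i) →ₗ[ℤ] S.Total :=
    ∑ i : Fin (c + 1), (S.of i).toIntLinearMap ∘ₗ LinearMap.proj i
  refine Module.Finite.of_surjective f ?_
  rw [← LinearMap.range_eq_top, eq_top_iff]
  intro a _
  induction a using total_induction with
  | add a b ha hb => exact add_mem (ha Submodule.mem_top) (hb Submodule.mem_top)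
  | hom n x hx =>
    by_cases hn : n < c + 1
    · refine ⟨Pi.single ⟨n, hn⟩ (S.cls n x hx), ?_⟩
      simp only [f, LinearMap.sum_apply, LinearMap.comp_apply, LinearMap.proj_apply]
      rw [Finset.sum_eq_single (⟨n, hn⟩ : Fin (c + 1))]
      · simp [hcls]
      · intro b _ hb
        simp [Pi.single_eq_of_ne hb]
      · simp
    · have : S.hcls n x hx = 0 := by
        rw [hcls, cls_eq_zero_iff.mpr, map_zero]
        rwa [hc n (by omega)]
      rw [this]
      exact zero_mem _

/-- The additive subgroup spanned by the homogeneous elements of degree at least `k`. -/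
noncomputable def degreeGE (k : ℕ) : AddSubgroup S.Total :=
  AddSubgroup.closure {a | ∃ n x hx, k ≤ n ∧ S.hcls n x hx = a}

variable {S}

theorem lie_mem_degreeGE {k : ℕ} (a : S.Total) {b : S.Total} (hb : b ∈ S.degreeGE k) :
    ⁅a, b⁆ ∈ S.degreeGE (k + 1) := by
  induction hb using AddSubgroup.closure_induction with
  | zero => simp [zero_mem]
  | add b b' _ _ h h' => rw [lie_add]; exact add_mem h h'
  | neg b _ h => rw [lie_neg]; exact neg_mem h
  | mem b hb =>
    obtain ⟨n, x, hx, hn, rfl⟩ := hb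
    induction a using total_induction with
    | add a a' h h' => rw [add_lie]; exact add_mem h h'
    | hom m y hy =>
      rw [lie_hcls]
      exact AddSubgroup.subset_closure ⟨_, _, _, by omega, rfl⟩

theorem degreeGE_succ_le (k : ℕ) : S.degreeGE (k + 1) ≤ S.degreeGE k :=
  AddSubgroup.closure_mono fun _ ⟨n, x, hx, hn, h⟩ => ⟨n, x, hx, by omega, h⟩

/-- If `E n = lcs G n` for `n > c`, the graded Lie ring vanishes above degree `c`. Its derived series
descends through the degree filtration, so it is solvable. -/
theorem isSolvable_total {c : ℕ} (hc : ∀ n, c < n → S.E n = lcs G n) :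
    LieAlgebra.IsSolvable S.Total := by
  let I : ℕ → LieIdeal ℤ S.Total := fun k =>
    { (S.degreeGE k).toIntSubmodule with
      lie_mem := fun {a b} hb => degreeGE_succ_le k (lie_mem_degreeGE a hb) }
  have hI : ∀ k, LieAlgebra.derivedSeries ℤ S.Total k ≤ I k := by
    intro k
    induction k with
    | zero =>
      intro a _
      induction a using total_induction with
      | add a b ha hb =>
        exact add_mem (ha (LieSubmodule.mem_top a)) (hb (LieSubmodule.mem_top b))
      | hom n x hx => exact AddSubgroup.subset_closure ⟨n, x, hx, Nat.zero_le n, rfl⟩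
    | succ k ih =>
      rw [LieAlgebra.derivedSeries_def, LieAlgebra.derivedSeriesOfIdeal_succ,
        LieSubmodule.lie_le_iff]
      intro a _ b hb
      exact lie_mem_degreeGE a (ih hb)
  refine LieAlgebra.IsSolvable.mk (R := ℤ) (k := c + 1) ?_
  rw [eq_bot_iff]
  refine (hI (c + 1)).trans fun a ha => ?_
  have h0 : S.degreeGE (c + 1) ≤ ⊥ := by
    rw [degreeGE, AddSubgroup.closure_le]
    rintro _ ⟨n, x, hx, hn, rfl⟩
    rw [hcls, cls_eq_zero_iff.mpr, map_zero]
    · exact zero_mem _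
    · rwa [hc n (by omega)]
  exact (LieSubmodule.mem_bot a).mpr (h0 ha)

variable (G)

/-- The choice `E n = lcs G (n + 1)`, for which the graded Lie ring is that of the lower central
series. -/
def graded : LCSQuotients G where
  E n := lcs G (n + 1)
  normal _ := inferInstance
  succ_le _ := le_rfl
  comm_mem m n x hx _ y hy := by
    have := commutatorElement_mem_lcs hx hy
    rwa [show m + 1 + n + 1 = m + n + 1 + 1 by omega] at this

/-- The graded Lie ring of the lower central series, reduced modulo `p` and truncated above degree
`c`. Here `E n` consists of the elements whose class in degree `n` is divisible by `p` if `n ≤ c`, and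
of all of `lcs G n` if `n > c`. -/
def gradedMod (p c : ℕ) : LCSQuotients G where
  E n :=
    { carrier := {x | ∃ hx : x ∈ lcs G n, n ≤ c → ∃ a, p • a = (graded G).cls n x hx}
      mul_mem' := by
        rintro x y ⟨hx, h⟩ ⟨hy, h'⟩
        refine ⟨mul_mem hx hy, fun hn => ?_⟩
        obtain ⟨a, ha⟩ := h hn
        obtain ⟨b, hb⟩ := h' hn
        exact ⟨a + b, by rw [smul_add, ha, hb, cls_mul]⟩
      one_mem' := ⟨one_mem _, fun _ => ⟨0, smul_zero p⟩⟩
      inv_mem' := by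
        rintro x ⟨hx, h⟩
        refine ⟨inv_mem hx, fun hn => ?_⟩
        obtain ⟨a, ha⟩ := h hn
        exact ⟨-a, by rw [smul_neg, ha, cls_inv]⟩ }
  normal n :=
    { conj_mem := by
        rintro x ⟨hx, h⟩ g
        refine ⟨(inferInstance : (lcs G n).Normal).conj_mem x hx g, fun hn => ?_⟩
        rw [cls_conj g hx]
        exact h hn }
  succ_le n x hx := ⟨lcs_anti n.le_succ hx, fun _ => ⟨0, by
    rw [smul_zero, eq_comm, cls_eq_zero_iff]
    exact hx⟩⟩
  comm_mem := by
    rintro m n x ⟨_, h⟩ hx y hy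
    refine ⟨commutatorElement_mem_lcs hx hy, fun hn => ?_⟩
    obtain ⟨a, ha⟩ := h (by omega)
    exact ⟨(graded G).lieHom m n a ((graded G).cls n y hy), by
      rw [← lieHom_cls _ hx hy, ← ha, map_nsmul, AddMonoidHom.nsmul_apply]⟩

variable {G}

theorem gradedMod_E_of_lt {p c n : ℕ} (hn : c < n) : (gradedMod G p c).E n = lcs G n :=
  le_antisymm (fun _ hx => hx.1) fun _ hx => ⟨hx, fun h => absurd hn (by omega)⟩

theorem nsmul_gradedMod_total (p c : ℕ) (a : (gradedMod G p c).Total) : p • a = 0 := by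
  induction a using total_induction with
  | add a b ha hb => rw [smul_add, ha, hb, add_zero]
  | hom n x hx =>
    rw [hcls, ← map_nsmul, ← cls_pow, cls_eq_zero_iff.mpr, map_zero]
    exact ⟨pow_mem hx p, fun _ => ⟨(graded G).cls n x hx, (cls_pow hx p).symm⟩⟩

noncomputable instance (p c : ℕ) : Module (ZMod p) (gradedMod G p c).Total :=
  AddCommGroup.zmodModule (nsmul_gradedMod_total p c)

noncomputable instance (p c : ℕ) : LieAlgebra (ZMod p) (gradedMod G p c).Total where
  lie_smul t x y := ZMod.map_smul (AddMonoidHom.mk' (fun y => ⁅x, y⁆) (lie_add x)) t y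

instance (p c : ℕ) [Group.FG G] : Module.Finite (ZMod p) (gradedMod G p c).Total :=
  have := (gradedMod G p c).total_finite (fun _ => gradedMod_E_of_lt)
  have : IsScalarTower ℤ (ZMod p) (gradedMod G p c).Total := AddCommGroup.intIsScalarTower
  Module.Finite.of_restrictScalars_finite ℤ (ZMod p) _

instance (p c : ℕ) : LieAlgebra.IsSolvable (gradedMod G p c).Total :=
  isSolvable_total (fun _ => gradedMod_E_of_lt)

/-- An element of `lcs G c` whose class vanishes in the enveloping algebra of the Lie algebra modulo
`p` has a class divisible by `p`. -/
theorem exists_nsmul_of_ι_eq_zero [Group.FG G] {p c : ℕ} [Fact p.Prime] {x : G} {hx : x ∈ lcs G c}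
    (h : UniversalEnvelopingAlgebra.ι (ZMod p) ((gradedMod G p c).hcls c x hx) = 0) :
    ∃ a, p • a = (graded G).cls c x hx := by
  have h1 := UniversalEnvelopingAlgebra.ι_injective_of_isSolvable _ (h.trans (map_zero _).symm)
  have h2 : (gradedMod G p c).cls c x hx = 0 := of_injective c (h1.trans (map_zero _).symm)
  rw [cls_eq_zero_iff] at h2
  exact h2.2 le_rfl

end LCSQuotients
end ModP

/-! ### The Magnus homomorphism -/

section Magnus

open scoped commutatorElement PowerSeries
open PowerSeries (X C constantCoeff)

attribute [local instance] LieRing.ofAssociativeRing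

variable {B B' : Type*} [Ring B] [Ring B']

/-- The power series `u` has the form `1 + b X ^ n + ⋯`. The coefficient `b` may vanish. -/
def HasLead (u : B⟦X⟧ˣ) (n : ℕ) (b : B) : Prop :=
  ∃ Y : B⟦X⟧, (u : B⟦X⟧) = 1 + X ^ n * Y ∧ constantCoeff Y = b

namespace HasLead

variable {u v : B⟦X⟧ˣ} {m n : ℕ} {b c : B}

theorem one (n : ℕ) : HasLead (1 : B⟦X⟧ˣ) n 0 := ⟨0, by simp, by simp⟩

theorem unique (h : HasLead u n b) (h' : HasLead u n c) : b = c := by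
  obtain ⟨Y, hY, rfl⟩ := h
  obtain ⟨Z, hZ, rfl⟩ := h'
  have h := add_left_cancel (hY.symm.trans hZ)
  have h2 := congrArg (PowerSeries.coeff (0 + n)) h
  rw [PowerSeries.coeff_X_pow_mul, PowerSeries.coeff_X_pow_mul] at h2
  simpa using h2

theorem of_succ (h : HasLead u (n + 1) b) : HasLead u n 0 := by
  obtain ⟨Y, hY, rfl⟩ := h
  exact ⟨X * Y, by rw [hY, pow_succ, mul_assoc], by simp⟩

theorem mul (hn : n ≠ 0) (h : HasLead u n b) (h' : HasLead v n c) : HasLead (u * v) n (b + c) := by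
  obtain ⟨Y, hY, rfl⟩ := h
  obtain ⟨Z, hZ, rfl⟩ := h'
  refine ⟨Y + Z + Y * X ^ n * Z, ?_, by simp [hn]⟩
  rw [Units.val_mul, hY, hZ]
  noncomm_ring

theorem constantCoeff_eq (hn : n ≠ 0) (h : HasLead u n b) : constantCoeff (u : B⟦X⟧) = 1 := by
  obtain ⟨Y, hY, rfl⟩ := h
  simp [hY, hn]

theorem constantCoeff_inv (hn : n ≠ 0) (h : HasLead u n b) :
    constantCoeff ((u⁻¹ : B⟦X⟧ˣ) : B⟦X⟧) = 1 := by
  have h1 := congrArg constantCoeff u.mul_inv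
  rwa [map_mul, h.constantCoeff_eq hn, one_mul, map_one] at h1

theorem inv (hn : n ≠ 0) (h : HasLead u n b) : HasLead u⁻¹ n (-b) := by
  have h1 := h.constantCoeff_inv hn
  obtain ⟨Y, hY, rfl⟩ := h
  refine ⟨-(Y * (u⁻¹ : B⟦X⟧ˣ)), ?_, by simp [h1]⟩
  have h2 := u.mul_inv
  rw [hY, add_mul, one_mul, mul_assoc] at h2
  rw [mul_neg, ← sub_eq_add_neg]
  exact eq_sub_of_add_eq h2

theorem pow (hn : n ≠ 0) (h : HasLead u n b) (k : ℕ) : HasLead (u ^ k) n (k • b) := by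
  induction k with
  | zero => simpa using one n
  | succ k ih => rw [pow_succ, succ_nsmul]; exact ih.mul hn h

theorem commutator (hm : m ≠ 0) (hn : n ≠ 0) (h : HasLead u m b) (h' : HasLead v n c) :
    HasLead ⁅u, v⁆ (m + n) (b * c - c * b) := by
  have hu := h.constantCoeff_inv hm
  have hv := h'.constantCoeff_inv hn
  obtain ⟨Y, hY, rfl⟩ := h
  obtain ⟨Z, hZ, rfl⟩ := h'
  refine ⟨(Y * Z - Z * Y) * (u⁻¹ : B⟦X⟧ˣ) * (v⁻¹ : B⟦X⟧ˣ), ?_, by simp [hu, hv]⟩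
  have key : (u : B⟦X⟧) * (v : B⟦X⟧) - (v : B⟦X⟧) * (u : B⟦X⟧) = X ^ (m + n) * (Y * Z - Z * Y) := by
    have e1 := (PowerSeries.commute_X_pow Y n).eq
    have e2 := (PowerSeries.commute_X_pow Z m).eq
    have e3 : X ^ m * Y * (X ^ n * Z) = X ^ (m + n) * (Y * Z) := by
      rw [mul_assoc, ← mul_assoc Y, e1, pow_add]
      simp only [mul_assoc]
    have e4 : X ^ n * Z * (X ^ m * Y) = X ^ (m + n) * (Z * Y) := by
      rw [mul_assoc, ← mul_assoc Z, e2, add_comm m n, pow_add]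
      simp only [mul_assoc]
    rw [hY, hZ, mul_sub, ← e3, ← e4]
    noncomm_ring
  rw [← mul_assoc, ← mul_assoc, ← key, commutatorElement_def, sub_mul, sub_mul]
  simp [mul_assoc]

theorem map (f : B →+* B') (h : HasLead u n b) :
    HasLead (Units.map (PowerSeries.map f : B⟦X⟧ →* B'⟦X⟧) u) n (f b) := by
  obtain ⟨Y, hY, rfl⟩ := h
  exact ⟨PowerSeries.map f Y, by simp [hY], by
    rw [← PowerSeries.coeff_zero_eq_constantCoeff_apply, PowerSeries.coeff_map]; simp⟩

end HasLead

/-- The unit `1 + b X`. -/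
noncomputable def magnusUnit (b : B) : B⟦X⟧ˣ :=
  (PowerSeries.isUnit_iff_constantCoeff.mpr (by simp) : IsUnit (1 + X * C b : B⟦X⟧)).unit

theorem magnusUnit_val (b : B) : (magnusUnit b : B⟦X⟧) = 1 + X * C b := rfl

theorem hasLead_magnusUnit (b : B) : HasLead (magnusUnit b) 1 b :=
  ⟨C b, by rw [magnusUnit_val, pow_one], by simp⟩

theorem commute_magnusUnit {b c : B} (h : Commute b c) :
    Commute (magnusUnit b) (magnusUnit c) := by
  refine Units.ext ?_
  rw [Units.val_mul, Units.val_mul]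
  change Commute (1 + X * C b : B⟦X⟧) (1 + X * C c)
  have h1 : Commute (C b) (C c) := h.map (C (R := B))
  have h2 : ∀ a : B⟦X⟧, Commute X a := fun a => (PowerSeries.commute_X a).symm
  exact (Commute.one_left _).add_left (((Commute.one_right _).add_right
    ((h2 _).mul_left ((h2 _).symm.mul_right h1))))

variable {V : Type*} {Γ : SimpleGraph V}

/-- The homomorphism `v ↦ 1 + b v X` attached to elements `b v` that commute for adjacent vertices. -/
noncomputable def magnus (b : V → B) (hb : ∀ u v, Γ.Adj u v → Commute (b u) (b v)) :
    RAAG Γ →* B⟦X⟧ˣ :=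
  PresentedGroup.toGroup (f := fun v => magnusUnit (b v)) (by
    rintro _ ⟨u, v, h, rfl⟩
    simpa [commutatorElement_def] using
      commutatorElement_eq_one_iff_commute.mpr (commute_magnusUnit (hb u v h)))

theorem magnus_of (b : V → B) (hb : ∀ u v, Γ.Adj u v → Commute (b u) (b v)) (v : V) :
    magnus b hb (PresentedGroup.of v) = magnusUnit (b v) :=
  PresentedGroup.toGroup.of _

/-- The Magnus homomorphism is natural in the ring. -/
theorem map_magnus (f : B →+* B') {b : V → B} (hb : ∀ u v, Γ.Adj u v → Commute (b u) (b v))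
    (b' : V → B') (hb' : ∀ u v, Γ.Adj u v → Commute (b' u) (b' v)) (hf : ∀ v, f (b v) = b' v)
    (x : RAAG Γ) :
    Units.map (PowerSeries.map f : B⟦X⟧ →* B'⟦X⟧) (magnus b hb x) = magnus b' hb' x := by
  suffices h : (Units.map (PowerSeries.map f : B⟦X⟧ →* B'⟦X⟧)).comp (magnus b hb) = magnus b' hb'
    from DFunLike.congr_fun h x
  refine PresentedGroup.ext fun v => Units.ext ?_
  rw [MonoidHom.comp_apply, magnus_of, magnus_of]
  simp [magnusUnit_val, hf]

theorem raag_induction {p : RAAG Γ → Prop} (of : ∀ v, p (PresentedGroup.of v)) (one : p 1)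
    (mul : ∀ x y, p x → p y → p (x * y)) (inv : ∀ x, p x → p x⁻¹) (x : RAAG Γ) : p x := by
  have hx : x ∈ Subgroup.closure (Set.range (PresentedGroup.of (rels := raagRelators Γ))) := by
    rw [PresentedGroup.closure_range_of]
    exact Subgroup.mem_top x
  refine Subgroup.closure_induction (p := fun x _ => p x) ?_ one (fun x y _ _ => mul x y)
    (fun x _ => inv x) hx
  rintro _ ⟨v, rfl⟩
  exact of v

theorem exists_hasLead_magnus (b : V → B) (hb : ∀ u v, Γ.Adj u v → Commute (b u) (b v)) (n : ℕ) :
    ∀ x ∈ lcs (RAAG Γ) n, ∃ a, HasLead (magnus b hb x) (n + 1) a := by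
  have h0 : ∀ x, ∃ a, HasLead (magnus b hb x) 1 a := by
    apply raag_induction
    · exact fun v => ⟨b v, by rw [magnus_of]; exact hasLead_magnusUnit _⟩
    · exact ⟨0, by rw [map_one]; exact HasLead.one _⟩
    · rintro x y ⟨a, ha⟩ ⟨c, hc⟩
      exact ⟨a + c, by rw [map_mul]; exact ha.mul one_ne_zero hc⟩
    · rintro x ⟨a, ha⟩
      exact ⟨-a, by rw [map_inv]; exact ha.inv one_ne_zero⟩
  induction n with
  | zero => exact fun x _ => h0 x
  | succ n ih =>
    apply lcs_succ_induction
    · intro x hx g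
      obtain ⟨a, ha⟩ := ih x hx
      obtain ⟨c, hc⟩ := h0 g
      exact ⟨_, by rw [map_commutatorElement]; exact ha.commutator n.succ_ne_zero one_ne_zero hc⟩
    · exact ⟨0, by rw [map_one]; exact HasLead.one _⟩
    · rintro x - y - ⟨a, ha⟩ ⟨c, hc⟩
      exact ⟨a + c, by rw [map_mul]; exact ha.mul (Nat.succ_ne_zero _) hc⟩
    · rintro x - ⟨a, ha⟩
      exact ⟨-a, by rw [map_inv]; exact ha.inv (Nat.succ_ne_zero _)⟩

open LCSQuotients UniversalEnvelopingAlgebra in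
/-- With values in the enveloping algebra of the graded Lie algebra, the leading coefficient of the
Magnus homomorphism at `x` is the class of `x`. -/
theorem hasLead_magnus_enveloping (S : LCSQuotients (RAAG Γ)) {k : Type*} [CommRing k]
    [LieAlgebra k S.Total] (b : V → UniversalEnvelopingAlgebra k S.Total)
    (hb : ∀ u v, Γ.Adj u v → Commute (b u) (b v))
    (hS : ∀ v, b v = ι k (S.hcls 0 (PresentedGroup.of v) (Subgroup.mem_top _))) (n : ℕ) :
    ∀ x ∈ lcs (RAAG Γ) n, ∃ hx : x ∈ lcs (RAAG Γ) n,
      HasLead (magnus b hb x) (n + 1) (ι k (S.hcls n x hx)) := by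
  have h0 : ∀ x, ∃ hx : x ∈ lcs (RAAG Γ) 0,
      HasLead (magnus b hb x) 1 (ι k (S.hcls 0 x hx)) := by
    apply raag_induction
    · exact fun v => ⟨Subgroup.mem_top _, by rw [magnus_of, ← hS]; exact hasLead_magnusUnit _⟩
    · exact ⟨one_mem _, by rw [map_one, hcls_one, map_zero]; exact HasLead.one _⟩
    · rintro x y ⟨hx, ha⟩ ⟨hy, hc⟩
      exact ⟨mul_mem hx hy, by rw [map_mul, hcls_mul hx hy, map_add]; exact ha.mul one_ne_zero hc⟩
    · rintro x ⟨hx, ha⟩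
      exact ⟨inv_mem hx, by rw [map_inv, hcls_inv hx, map_neg]; exact ha.inv one_ne_zero⟩
  induction n with
  | zero => exact fun x _ => h0 x
  | succ n ih =>
    apply lcs_succ_induction
    · intro x hx g
      obtain ⟨_, ha⟩ := ih x hx
      obtain ⟨hg, hc⟩ := h0 g
      have h : ⁅x, g⁆ ∈ lcs (RAAG Γ) (n + 1) := Subgroup.commutator_mem_commutator hx hg
      have h' : ⁅S.hcls n x hx, S.hcls 0 g hg⁆ = S.hcls (n + 1) ⁅x, g⁆ h := lie_hcls hx hg
      refine ⟨h, ?_⟩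
      rw [map_commutatorElement, ← h', LieHom.map_lie, LieRing.of_associative_ring_bracket]
      exact ha.commutator n.succ_ne_zero one_ne_zero hc
    · exact ⟨one_mem _, by rw [map_one, hcls_one, map_zero]; exact HasLead.one _⟩
    · rintro x - y - ⟨hx, ha⟩ ⟨hy, hc⟩
      exact ⟨mul_mem hx hy, by
        rw [map_mul, hcls_mul hx hy, map_add]; exact ha.mul (Nat.succ_ne_zero _) hc⟩
    · rintro x - ⟨hx, ha⟩
      exact ⟨inv_mem hx, by
        rw [map_inv, hcls_inv hx, map_neg]; exact ha.inv (Nat.succ_ne_zero _)⟩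

end Magnus

/-! ### The trace monoid and the centre of its algebra -/

section Trace

variable {V : Type*} (Γ : SimpleGraph V)

/-- The relations `u v = v u` for adjacent letters `u` and `v`. -/
def traceRel (a b : FreeMonoid V) : Prop :=
  ∃ u v, Γ.Adj u v ∧ a = FreeMonoid.of u * FreeMonoid.of v ∧
    b = FreeMonoid.of v * FreeMonoid.of u

/-- The trace monoid of `Γ`: the free partially commutative monoid in which adjacent letters
commute. -/
abbrev TraceMonoid : Type _ := PresentedMonoid (traceRel Γ)

namespace TraceMonoid

variable {Γ}

/-- The class of a one-letter word. -/
abbrev letter (v : V) : TraceMonoid Γ := PresentedMonoid.of (traceRel Γ) v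

theorem letter_mul_comm {u v : V} (h : Γ.Adj u v) :
    (letter u * letter v : TraceMonoid Γ) = letter v * letter u :=
  PresentedMonoid.mk_eq_mk_of_rel ⟨u, v, h, rfl, rfl⟩

theorem eq_one_or_eq_letter_mul (m : TraceMonoid Γ) : m = 1 ∨ ∃ v m', m = letter v * m' := by
  induction m using PresentedMonoid.inductionOn with
  | h a =>
    cases a using FreeMonoid.casesOn with
    | one => exact Or.inl (map_one _)
    | of_mul v a => exact Or.inr ⟨v, PresentedMonoid.mk _ a, map_mul _ _ _⟩

open Classical in
/-- Erasing the first occurrence of a letter is compatible with commutation of adjacent letters. -/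
theorem erase_congr (u : V) {a b : FreeMonoid V} (h : conGen (traceRel Γ) a b) :
    (u ∈ a.toList ↔ u ∈ b.toList) ∧
      conGen (traceRel Γ) (FreeMonoid.ofList (a.toList.erase u))
        (FreeMonoid.ofList (b.toList.erase u)) := by
  change ConGen.Rel _ a b at h
  induction h with
  | of a b h =>
    obtain ⟨v, w, hvw, rfl, rfl⟩ := h
    have hne := hvw.ne
    simp only [FreeMonoid.toList_mul, FreeMonoid.toList_of, List.cons_append, List.nil_append]
    refine ⟨by simp [or_comm], ?_⟩
    by_cases h1 : v = u
    · subst h1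
      rw [List.erase_cons_head, List.erase_cons_tail (by simpa using hne.symm),
        List.erase_cons_head]
      exact (conGen _).refl _
    · by_cases h2 : w = u
      · subst h2
        rw [List.erase_cons_head, List.erase_cons_tail (by simpa using hne),
          List.erase_cons_head]
        exact (conGen _).refl _
      · rw [List.erase_of_not_mem, List.erase_of_not_mem]
        · exact ConGen.Rel.of _ _ ⟨v, w, hvw, rfl, rfl⟩
        all_goals simp [Ne.symm h1, Ne.symm h2]
  | refl a => exact ⟨Iff.rfl, (conGen _).refl _⟩
  | symm _ ih => exact ⟨ih.1.symm, (conGen _).symm ih.2⟩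
  | trans _ _ ih ih' => exact ⟨ih.1.trans ih'.1, (conGen _).trans ih.2 ih'.2⟩
  | @mul a b c d h h' ih ih' =>
    rw [FreeMonoid.toList_mul, FreeMonoid.toList_mul, List.mem_append, List.mem_append,
      List.erase_append, List.erase_append]
    refine ⟨by rw [ih.1, ih'.1], ?_⟩
    by_cases hu : u ∈ a.toList
    · rw [if_pos hu, if_pos (ih.1.mp hu), FreeMonoid.ofList_append, FreeMonoid.ofList_append]
      exact (conGen _).mul ih.2 h'
    · rw [if_neg hu, if_neg (fun hb => hu (ih.1.mpr hb)), FreeMonoid.ofList_append,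
        FreeMonoid.ofList_append]
      exact (conGen _).mul h ih'.2

/-- Erasing the first occurrence of `u` is a left inverse of left multiplication by `u`. -/
theorem letter_mul_injective (u : V) :
    Function.Injective fun m : TraceMonoid Γ => letter u * m := by
  classical
  intro m m' h
  induction m using PresentedMonoid.inductionOn with
  | h a =>
  induction m' using PresentedMonoid.inductionOn with
  | h b =>
  have h1 : PresentedMonoid.mk (traceRel Γ) (FreeMonoid.of u * a) =
      PresentedMonoid.mk (traceRel Γ) (FreeMonoid.of u * b) := h
  have h2 := (erase_congr u (PresentedMonoid.mk_eq_mk_iff.mp h1)).2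
  refine PresentedMonoid.mk_eq_mk_iff.mpr ?_
  simpa [FreeMonoid.toList_of_mul] using h2

theorem letter_pow_mul_injective (u : V) (n : ℕ) :
    Function.Injective fun m : TraceMonoid Γ => letter u ^ n * m := by
  induction n with
  | zero => intro m m' h; simpa using h
  | succ n ih =>
    intro m m' h
    simp only [pow_succ, mul_assoc] at h
    exact letter_mul_injective u (ih h)

open Classical in
/-- The homomorphism to the free monoid that deletes all letters other than `u` and `v`, which must
not be adjacent. -/
noncomputable def pairProj (u v : V) (h : ¬ Γ.Adj u v) : TraceMonoid Γ →* FreeMonoid V :=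
  PresentedMonoid.lift (fun w => if w = u ∨ w = v then FreeMonoid.of w else 1) (by
    rintro _ _ ⟨a, b, hab, rfl, rfl⟩
    simp only [map_mul, FreeMonoid.lift_eval_of]
    by_cases ha : a = u ∨ a = v
    · by_cases hb : b = u ∨ b = v
      · rcases ha with rfl | rfl <;> rcases hb with rfl | rfl
        · rfl
        · exact absurd hab h
        · exact absurd hab.symm h
        · rfl
      · simp [hb]
    · simp [ha])

theorem pairProj_left (u v : V) (h : ¬ Γ.Adj u v) :
    pairProj u v h (letter u) = FreeMonoid.of u := by
  rw [pairProj, PresentedMonoid.lift_of, if_pos (Or.inl rfl)]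

theorem pairProj_right (u v : V) (h : ¬ Γ.Adj u v) :
    pairProj u v h (letter v) = FreeMonoid.of v := by
  rw [pairProj, PresentedMonoid.lift_of, if_pos (Or.inr rfl)]

/-- After deleting the letters other than `u` and `v`, the first `v` on the left is preceded by at
least `n` letters `u`, on the right by fewer. -/
theorem letter_pow_mul_ne {u v : V} (huv : u ≠ v) (h : ¬ Γ.Adj u v) (m m' : TraceMonoid Γ) {n : ℕ}
    (hn : (pairProj u v h m').length < n) :
    letter u ^ n * (letter v * m) ≠ m' * letter u ^ n := by
  intro he
  have h1 := congrArg (fun m => (pairProj u v h m).toList) he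
  have hpow : ∀ n, (FreeMonoid.of u ^ n).toList = List.replicate n u := by
    intro n
    induction n with
    | zero => rfl
    | succ n ih => rw [pow_succ', FreeMonoid.toList_of_mul, ih, List.replicate_succ]
  simp only [map_mul, map_pow, pairProj_left, pairProj_right, FreeMonoid.toList_mul, hpow,
    FreeMonoid.toList_of] at h1
  have hv : v ∈ (pairProj u v h m').toList := by
    have : v ∈ (pairProj u v h m').toList ++ List.replicate n u := by
      rw [← h1]
      simp
    rcases List.mem_append.mp this with h2 | h2
    · exact h2
    · exact absurd (List.eq_of_mem_replicate h2).symm huv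
  have hpre : (pairProj u v h m').toList <+: List.replicate n u :=
    List.prefix_of_prefix_length_le (List.prefix_append _ _) (h1 ▸ List.prefix_append _ _)
      (by rw [List.length_replicate]; exact hn.le)
  exact huv (List.eq_of_mem_replicate (hpre.subset hv)).symm

open MonoidAlgebra in
/-- If no letter commutes with all others, the centre of the algebra of the trace monoid consists of
the constants. A central `y` with a nonconstant monomial `v m` commutes with high powers of a letter
`u` not adjacent to `v`, contrary to `letter_pow_mul_ne`. -/
theorem eq_zero_of_commute {k : Type*} [Ring k] (hΓ : ∀ v, ∃ u, u ≠ v ∧ ¬ Γ.Adj u v)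
    (y : MonoidAlgebra k (TraceMonoid Γ)) (h1 : y.coeff 1 = 0)
    (hy : ∀ v, Commute (single (letter v) 1) y) : y = 0 := by
  classical
  by_contra h0
  obtain ⟨m, hm⟩ : ∃ m, y.coeff m ≠ 0 := by
    by_contra! h
    exact h0 (MonoidAlgebra.ext (Finsupp.ext h))
  rcases eq_one_or_eq_letter_mul m with rfl | ⟨v, m, rfl⟩
  · exact hm h1
  obtain ⟨u, huv, hadj⟩ := hΓ v
  let n := y.coeff.support.sup (fun m => (pairProj u v hadj m).length) + 1
  have hc : Commute (single (letter u ^ n) 1) y := by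
    have := (hy u).pow_left n
    rwa [single_pow, one_pow] at this
  have h2 : (single (letter u ^ n) 1 * y).coeff (letter u ^ n * (letter v * m)) ≠ 0 := by
    rw [coeff_single_mul_eq_mul_coeff _ (fun a _ => (letter_pow_mul_injective u n).eq_iff), one_mul]
    exact hm
  rw [hc.eq] at h2
  have h3 := support_coeff_mul_single_subset _ _ _ (Finsupp.mem_support_iff.mpr h2)
  obtain ⟨m', hm', he⟩ := Finset.mem_image.mp h3
  exact letter_pow_mul_ne huv hadj m m' (Nat.lt_succ_of_le (Finset.le_sup
    (f := fun m => (pairProj u v hadj m).length) hm')) he.symm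

end TraceMonoid
end Trace

/-! ### Leading terms of the Magnus homomorphism -/

section TraceMagnus

open scoped commutatorElement PowerSeries
open LCSQuotients TraceMonoid MonoidAlgebra

attribute [local instance] LieRing.ofAssociativeRing

variable {V : Type*} {Γ : SimpleGraph V}

theorem raag_commute {u v : V} (h : Γ.Adj u v) :
    Commute (PresentedGroup.of u : RAAG Γ) (PresentedGroup.of v) := by
  rw [← commutatorElement_eq_one_iff_commute]
  exact PresentedGroup.one_of_mem (rels := raagRelators Γ) ⟨u, v, h, rfl⟩

instance raag_fg [Finite V] : Group.FG (RAAG Γ) :=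
  Group.fg_iff.mpr ⟨_, PresentedGroup.closure_range_of _, Set.finite_range _⟩

theorem letter_mul_ne_one (v : V) (m : TraceMonoid Γ) : letter v * m ≠ 1 := by
  let f : TraceMonoid Γ →* Multiplicative ℕ :=
    PresentedMonoid.lift (fun _ => Multiplicative.ofAdd 1) (by
      rintro _ _ ⟨u, v, -, rfl, rfl⟩
      rfl)
  intro h
  have h1 := congrArg (fun m => (f m).toAdd) h
  have h2 : f (letter v) = Multiplicative.ofAdd 1 := rfl
  simp [h2] at h1

theorem commute_single_letter (k : Type*) [CommRing k] (u v : V) (h : Γ.Adj u v) :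
    Commute (single (letter u : TraceMonoid Γ) (1 : k)) (single (letter v) 1) := by
  rw [Commute, SemiconjBy, single_mul_single, single_mul_single, letter_mul_comm h]

variable (Γ) in
/-- The Magnus homomorphism `v ↦ 1 + v X` over the algebra of the trace monoid. -/
noncomputable def traceMagnus (k : Type*) [CommRing k] :
    RAAG Γ →* (MonoidAlgebra k (TraceMonoid Γ))⟦X⟧ˣ :=
  magnus (fun v => single (letter v) 1) (commute_single_letter k)

theorem traceMagnus_of (k : Type*) [CommRing k] (v : V) :
    HasLead (traceMagnus Γ k (PresentedGroup.of v)) 1 (single (letter v) 1) := by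
  rw [traceMagnus, magnus_of]
  exact hasLead_magnusUnit _

theorem exists_hasLead_traceMagnus (k : Type*) [CommRing k] {n : ℕ} {x : RAAG Γ}
    (hx : x ∈ lcs (RAAG Γ) n) : ∃ a, HasLead (traceMagnus Γ k x) (n + 1) a :=
  exists_hasLead_magnus _ _ n x hx

open Classical in
/-- The augmentation that kills all letters reads off the constant term and trivializes the Magnus
homomorphism. -/
theorem coeff_one_of_hasLead {k : Type*} [CommRing k] {n : ℕ} {x : RAAG Γ}
    {a : MonoidAlgebra k (TraceMonoid Γ)} (h : HasLead (traceMagnus Γ k x) n a) : a.coeff 1 = 0 := by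
  let F : TraceMonoid Γ →* k := PresentedMonoid.lift (fun _ => 0) (by
    rintro _ _ ⟨u, v, -, rfl, rfl⟩
    simp)
  have hF : ∀ m : TraceMonoid Γ, F m = if m = 1 then 1 else 0 := by
    intro m
    rcases eq_one_or_eq_letter_mul m with rfl | ⟨v, m, rfl⟩
    · simp
    · have hz : F (letter v * m) = 0 := by
        rw [map_mul]
        exact zero_mul _
      have hne : letter v * m ≠ 1 := letter_mul_ne_one v m
      rw [hz, if_neg hne]
  let f : MonoidAlgebra k (TraceMonoid Γ) →ₐ[k] k := lift k k _ F
  have hf : ∀ a, f a = a.coeff 1 := by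
    intro a
    induction a using MonoidAlgebra.induction_linear with
    | zero => simp
    | add a b ha hb => simp [ha, hb]
    | single m r => simp [f, lift_single, hF, Finsupp.single_apply]
  have h1 := h.map f.toRingHom
  rw [traceMagnus, map_magnus _ _ (fun _ => 0) (fun _ _ _ => Commute.zero_left _)] at h1
  · have h2 : magnus (Γ := Γ) (fun _ => (0 : k)) (fun _ _ _ => Commute.zero_left _) = 1 := by
      refine PresentedGroup.ext fun v => Units.ext ?_
      rw [magnus_of, magnusUnit_val]
      simp
    rw [h2] at h1
    exact (hf a).symm.trans (h1.unique (HasLead.one n))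
  · intro v
    simp [f, lift_single, F, letter]

/-- The leading coefficient modulo `p` detects divisibility by `p`: the homomorphism from the algebra
of the trace monoid to the enveloping algebra of the graded Lie algebra sends the leading coefficient
of `x` to the class of `x`. -/
theorem exists_nsmul_of_hasLead_zero [Finite V] {p : ℕ} [Fact p.Prime] {n : ℕ} {x : RAAG Γ}
    (hx : x ∈ lcs (RAAG Γ) n) (h : HasLead (traceMagnus Γ (ZMod p) x) (n + 1) 0) :
    ∃ a, p • a = (graded (RAAG Γ)).cls n x hx := by
  let S := gradedMod (RAAG Γ) p n
  let U := UniversalEnvelopingAlgebra (ZMod p) S.Total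
  let b : V → U := fun v => UniversalEnvelopingAlgebra.ι (ZMod p)
    (S.hcls 0 (PresentedGroup.of v) (Subgroup.mem_top _))
  have hb : ∀ u v, Γ.Adj u v → Commute (b u) (b v) := by
    intro u v huv
    have h1 := congrArg (UniversalEnvelopingAlgebra.ι (ZMod p))
      (lie_hcls (S := S) (m := 0) (n := 0) (Subgroup.mem_top (PresentedGroup.of u))
        (Subgroup.mem_top (PresentedGroup.of v)))
    have h2 := commutatorElement_eq_one_iff_commute.mpr (raag_commute huv)
    rw [hcls_congr rfl h2 (hy := one_mem _), hcls_one, map_zero, LieHom.map_lie,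
      LieRing.of_associative_ring_bracket, sub_eq_zero] at h1
    exact h1
  let f : MonoidAlgebra (ZMod p) (TraceMonoid Γ) →ₐ[ZMod p] U :=
    lift (ZMod p) U _ (PresentedMonoid.lift b (by
      rintro _ _ ⟨u, v, huv, rfl, rfl⟩
      simpa using (hb u v huv).eq))
  have h1 := h.map f.toRingHom
  rw [traceMagnus, map_magnus f.toRingHom _ b hb, map_zero] at h1
  · obtain ⟨_, h2⟩ := hasLead_magnus_enveloping S b hb (fun _ => rfl) n x hx
    exact exists_nsmul_of_ι_eq_zero (h2.unique h1)
  · intro v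
    change f _ = _
    rw [lift_single, one_smul]
    rfl


theorem coeff_nsmul_apply {k M : Type*} [Semiring k] (r : ℕ) (a : MonoidAlgebra k M) (m : M) :
    (r • a).coeff m = r • a.coeff m := by
  change (coeffAddEquiv (r • a)) m = _
  rw [map_nsmul]
  rfl

theorem eq_zero_of_nsmul_eq_zero {M : Type*} {r : ℕ} (hr : r ≠ 0) {a : MonoidAlgebra ℤ M}
    (h : r • a = 0) : a = 0 := by
  refine MonoidAlgebra.ext (Finsupp.ext fun m => ?_)
  have h1 := congrArg (fun e : MonoidAlgebra ℤ M => e.coeff m) h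
  rw [coeff_nsmul_apply] at h1
  simpa [hr] using h1

theorem hasLead_traceMagnus_zero_of_mem {k : Type*} [CommRing k] {n : ℕ} {x : RAAG Γ}
    (hx : x ∈ lcs (RAAG Γ) (n + 1)) : HasLead (traceMagnus Γ k x) (n + 1) 0 :=
  (exists_hasLead_traceMagnus k hx).choose_spec.of_succ

/-- The leading coefficient depends only on the class in the graded Lie ring. -/
theorem hasLead_traceMagnus_of_cls_eq {k : Type*} [CommRing k] {n : ℕ} {x y : RAAG Γ}
    {hx : x ∈ lcs (RAAG Γ) n} {hy : y ∈ lcs (RAAG Γ) n}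
    (h : (graded (RAAG Γ)).cls n x hx = (graded (RAAG Γ)).cls n y hy)
    {a : MonoidAlgebra k (TraceMonoid Γ)} (hl : HasLead (traceMagnus Γ k x) (n + 1) a) :
    HasLead (traceMagnus Γ k y) (n + 1) a := by
  have h1 : HasLead (traceMagnus Γ k (x⁻¹ * y)) (n + 1) 0 :=
    hasLead_traceMagnus_zero_of_mem (cls_eq_iff.mp h)
  have h2 := hl.mul n.succ_ne_zero h1
  rwa [← map_mul, mul_inv_cancel_left, add_zero] at h2

theorem HasLead.traceMagnus_map {k k' : Type*} [CommRing k] [CommRing k'] (f : k →+* k') {n : ℕ}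
    {x : RAAG Γ} {a : MonoidAlgebra k (TraceMonoid Γ)} (h : HasLead (traceMagnus Γ k x) n a) :
    HasLead (traceMagnus Γ k' x) n (MonoidAlgebra.mapRingHom _ f a) := by
  have h1 := h.map (MonoidAlgebra.mapRingHom _ f)
  rwa [traceMagnus, map_magnus _ _ _ (commute_single_letter k') (by simp)] at h1

theorem HasLead.eq_zero_of_commutator {k : Type*} [CommRing k]
    (hΓ : ∀ v, ∃ u, u ≠ v ∧ ¬ Γ.Adj u v) {n : ℕ} {x : RAAG Γ}
    {a : MonoidAlgebra k (TraceMonoid Γ)} (h : HasLead (traceMagnus Γ k x) (n + 1) a)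
    (hc : ∀ v, HasLead (traceMagnus Γ k ⁅x, PresentedGroup.of v⁆) (n + 2) 0) : a = 0 := by
  refine eq_zero_of_commute hΓ a (coeff_one_of_hasLead h) fun v => ?_
  have h1 := h.commutator n.succ_ne_zero one_ne_zero (traceMagnus_of k v)
  rw [← map_commutatorElement] at h1
  exact (sub_eq_zero.mp (h1.unique (hc v))).symm

/-- The classes with vanishing integral leading coefficient form a group `K` with `K = p K` for every
prime `p`. As `K` is finitely generated, Nakayama's lemma gives an odd integer annihilating `K`; but
`K` is divisible by that integer, so `K = 0`. -/
theorem mem_lcs_succ_of_hasLead_zero [Finite V] {n : ℕ} {x : RAAG Γ}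
    (hx : x ∈ lcs (RAAG Γ) n) (h : HasLead (traceMagnus Γ ℤ x) (n + 1) 0) :
    x ∈ lcs (RAAG Γ) (n + 1) := by
  let K : Submodule ℤ ((graded (RAAG Γ)).Gr n) := AddSubgroup.toIntSubmodule
    { carrier := {a | ∃ x hx, HasLead (traceMagnus Γ ℤ x) (n + 1) 0 ∧
        (graded (RAAG Γ)).cls n x hx = a}
      zero_mem' := ⟨1, one_mem _, by rw [map_one]; exact HasLead.one _, cls_one⟩
      add_mem' := by
        rintro _ _ ⟨x, hx, h, rfl⟩ ⟨y, hy, h', rfl⟩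
        exact ⟨x * y, mul_mem hx hy, by
          rw [map_mul]; simpa using h.mul n.succ_ne_zero h', cls_mul hx hy⟩
      neg_mem' := by
        rintro _ ⟨x, hx, h, rfl⟩
        exact ⟨x⁻¹, inv_mem hx, by rw [map_inv]; simpa using h.inv n.succ_ne_zero, cls_inv hx⟩ }
  have hprime : ∀ p : ℕ, p.Prime → ∀ a ∈ K, ∃ b ∈ K, p • b = a := by
    rintro p hp _ ⟨x, hx, hl, rfl⟩
    have : Fact p.Prime := ⟨hp⟩
    have h1 := hl.traceMagnus_map (Int.castRingHom (ZMod p))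
    rw [map_zero] at h1
    obtain ⟨b, hb⟩ := exists_nsmul_of_hasLead_zero hx h1
    obtain ⟨y, hy, rfl⟩ := cls_surjective b
    refine ⟨_, ⟨y, hy, ?_, rfl⟩, hb⟩
    obtain ⟨d, hd⟩ := exists_hasLead_traceMagnus ℤ hy
    have h2 := hasLead_traceMagnus_of_cls_eq ((cls_pow hy p).trans hb)
      (by rw [map_pow]; exact hd.pow n.succ_ne_zero p)
    have h3 : p • d = 0 := h2.unique hl
    rwa [eq_zero_of_nsmul_eq_zero hp.ne_zero h3] at hd
  have hdiv : ∀ r : ℕ, r ≠ 0 → ∀ a ∈ K, ∃ b ∈ K, r • b = a := by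
    intro r
    induction r using Nat.recOnMul with
    | zero => simp
    | one => exact fun _ a ha => ⟨a, ha, one_smul _ a⟩
    | prime p hp => exact fun _ => hprime p hp
    | mul r s hr hs =>
      intro h a ha
      obtain ⟨b, hb, rfl⟩ := hr (left_ne_zero_of_mul h) a ha
      obtain ⟨c, hc, rfl⟩ := hs (right_ne_zero_of_mul h) b hb
      exact ⟨c, hc, mul_smul r s c⟩
  have hK : K.FG := IsNoetherian.noetherian K
  obtain ⟨r, hr, hr'⟩ := Submodule.exists_sub_one_mem_and_smul_eq_zero_of_fg_of_le_smul
    (Ideal.span {(2 : ℤ)}) K hK (fun a ha => by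
      obtain ⟨b, hb, rfl⟩ := hprime 2 Nat.prime_two a ha
      rw [← natCast_zsmul]
      exact Submodule.smul_mem_smul (Ideal.subset_span rfl) hb)
  have hr0 : r.natAbs ≠ 0 := by
    rw [Ideal.mem_span_singleton] at hr
    omega
  obtain ⟨b, hb, hb'⟩ := hdiv r.natAbs hr0 _ ⟨x, hx, h, rfl⟩
  have hb0 : r.natAbs • b = 0 := by
    rcases Int.natAbs_eq r with e | e
    · rw [← natCast_zsmul, ← e]
      exact hr' b hb
    · rw [← natCast_zsmul, ← neg_neg ((r.natAbs : ℤ)), ← e, neg_smul, hr' b hb, neg_zero]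
  exact cls_eq_zero_iff.mp (hb'.symm.trans hb0)

/-- The graded Lie ring of a right-angled Artin group is torsion-free. -/
theorem mem_lcs_succ_of_pow [Finite V] {n p : ℕ} (hp : p ≠ 0) {x : RAAG Γ}
    (hx : x ∈ lcs (RAAG Γ) n) (h : x ^ p ∈ lcs (RAAG Γ) (n + 1)) : x ∈ lcs (RAAG Γ) (n + 1) := by
  obtain ⟨d, hd⟩ := exists_hasLead_traceMagnus ℤ hx
  have h1 := (hd.pow n.succ_ne_zero p)
  rw [← map_pow] at h1
  have h3 := h1.unique (hasLead_traceMagnus_zero_of_mem h)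
  rw [eq_zero_of_nsmul_eq_zero hp h3] at hd
  exact mem_lcs_succ_of_hasLead_zero hx hd

/-- If no vertex is adjacent to all others, the graded Lie ring has trivial centre. -/
theorem mem_lcs_succ_of_commutator [Finite V] (hΓ : ∀ v, ∃ u, u ≠ v ∧ ¬ Γ.Adj u v) {n : ℕ}
    {x : RAAG Γ} (hx : x ∈ lcs (RAAG Γ) n)
    (h : ∀ v, ⁅x, PresentedGroup.of v⁆ ∈ lcs (RAAG Γ) (n + 2)) : x ∈ lcs (RAAG Γ) (n + 1) := by
  obtain ⟨d, hd⟩ := exists_hasLead_traceMagnus ℤ hx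
  have h0 := hd.eq_zero_of_commutator hΓ fun v => hasLead_traceMagnus_zero_of_mem (h v)
  rw [h0] at hd
  exact mem_lcs_succ_of_hasLead_zero hx hd

/-- If no vertex is adjacent to all others, the graded Lie ring modulo `p` has trivial centre. -/
theorem exists_pow_of_commutator [Finite V] (hΓ : ∀ v, ∃ u, u ≠ v ∧ ¬ Γ.Adj u v) {n p : ℕ}
    [Fact p.Prime] {x : RAAG Γ} (hx : x ∈ lcs (RAAG Γ) n)
    (h : ∀ v, ∃ y ∈ lcs (RAAG Γ) (n + 1),
      (y ^ p)⁻¹ * ⁅x, PresentedGroup.of v⁆ ∈ lcs (RAAG Γ) (n + 2)) :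
    ∃ y ∈ lcs (RAAG Γ) n, (y ^ p)⁻¹ * x ∈ lcs (RAAG Γ) (n + 1) := by
  obtain ⟨d, hd⟩ := exists_hasLead_traceMagnus (ZMod p) hx
  have h0 := hd.eq_zero_of_commutator hΓ fun v => by
    obtain ⟨y, hy, hyv⟩ := h v
    obtain ⟨e, he⟩ := exists_hasLead_traceMagnus (ZMod p) hy
    have h1 := (he.pow (Nat.succ_ne_zero _) p).mul (Nat.succ_ne_zero _)
      (hasLead_traceMagnus_zero_of_mem (k := ZMod p) hyv)
    rw [← map_pow, ← map_mul, mul_inv_cancel_left, add_zero] at h1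
    have h2 : p • e = 0 := by
      refine MonoidAlgebra.ext (Finsupp.ext fun m => ?_)
      rw [coeff_nsmul_apply, nsmul_eq_mul, CharP.cast_eq_zero, zero_mul]
      rfl
    rwa [h2] at h1
  rw [h0] at hd
  obtain ⟨a, ha⟩ := exists_nsmul_of_hasLead_zero hx hd
  obtain ⟨y, hy, rfl⟩ := cls_surjective a
  exact ⟨y, hy, cls_eq_iff.mp ((cls_pow hy p).trans ha)⟩

theorem exists_not_adj (hZ : Subgroup.center (RAAG Γ) = ⊥) (v : V) :
    ∃ u, u ≠ v ∧ ¬ Γ.Adj u v := by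
  by_contra! h
  have hc : (PresentedGroup.of v : RAAG Γ) ∈ Subgroup.center (RAAG Γ) := by
    rw [Subgroup.mem_center_iff]
    apply raag_induction
    · intro u
      by_cases huv : u = v
      · rw [huv]
      · exact (raag_commute (h u huv)).eq
    · simp
    · intro x y hx hy
      rw [mul_assoc, hy, ← mul_assoc, hx, mul_assoc]
    · intro x hx
      exact ((show Commute x _ from hx).inv_left).eq
  rw [hZ, Subgroup.mem_bot] at hc
  have h1 := traceMagnus_of (Γ := Γ) ℤ v
  rw [hc, map_one] at h1
  have h2 := (HasLead.one 1).unique h1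
  have h3 := congrArg (fun e : MonoidAlgebra ℤ (TraceMonoid Γ) => e.coeff (letter v)) h2
  simp at h3

end TraceMagnus

/-! ### The Johnson homomorphism -/

section Johnson

open scoped commutatorElement
open LCSQuotients

section General

variable {A : Type*} [Group A]

theorem map_mul_mem {N : Subgroup A} [N.Normal] (φ : MulAut A) {x y : A} (hx : x⁻¹ * φ x ∈ N)
    (hy : y⁻¹ * φ y ∈ N) : (x * y)⁻¹ * φ (x * y) ∈ N := by
  have h := mul_mem ((inferInstance : N.Normal).conj_mem _ hx y⁻¹) hy
  simpa [mul_assoc] using h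

theorem map_inv_mem {N : Subgroup A} [N.Normal] (φ : MulAut A) {x : A} (hx : x⁻¹ * φ x ∈ N) :
    (x⁻¹)⁻¹ * φ x⁻¹ ∈ N := by
  have h := (inferInstance : N.Normal).conj_mem _ (inv_mem hx) x
  simpa [mul_assoc] using h

theorem johnsonAut_mono {m n : ℕ} (h : m ≤ n) : johnsonAut A n ≤ johnsonAut A m :=
  fun _ hφ => mem_johnsonAut_iff.mpr fun g => lcs_anti h (mem_johnsonAut_iff.mp hφ g)

/-- An automorphism acting trivially on the abelianization acts trivially on all quotients of the
lower central series, as these are generated by commutators. -/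
theorem inv_mul_map_mem_of_mem_johnsonAut_one {φ : MulAut A} (hφ : φ ∈ johnsonAut A 1) (n : ℕ) :
    ∀ x ∈ lcs A n, x⁻¹ * φ x ∈ lcs A (n + 1) := by
  rw [mem_johnsonAut_iff] at hφ
  induction n with
  | zero => exact fun x _ => hφ x
  | succ n ih =>
    apply lcs_succ_induction
    · intro x hx g
      have hφx : φ x ∈ lcs A n := by
        simpa using mul_mem hx (lcs_anti n.le_succ (ih x hx))
      rw [map_commutatorElement]
      exact cls_eq_iff.mp (cls_commutator_congr (S := graded A) (n := 0) hx hφx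
        (Subgroup.mem_top g) (Subgroup.mem_top (φ g)) (cls_eq_iff.mpr (ih x hx))
        (cls_eq_iff.mpr (hφ g)))
    · simp [one_mem]
    · exact fun x _ y _ hx hy => map_mul_mem φ hx hy
    · exact fun x _ hx => map_inv_mem φ hx

theorem conj_mem_johnsonAut {n : ℕ} {h : A} (hh : h ∈ lcs A n) :
    MulAut.conj h ∈ johnsonAut A (n + 1) := by
  rw [mem_johnsonAut_iff]
  intro g
  have h1 := commutatorElement_mem_lcs (m := 0) (Subgroup.mem_top g⁻¹) hh
  simpa [commutatorElement_def, mul_assoc] using h1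

/-- The natural epimorphism `G_c → H_c / H_{c+1}`. -/
def toJohnsonOutQuotient (A : Type*) [Group A] (c : ℕ) :
    johnsonAut A c →* JohnsonOutQuotient A c :=
  (QuotientGroup.mk' _).comp ((QuotientGroup.mk' (innerAut A)).subgroupMap (johnsonAut A c))

theorem toJohnsonOutQuotient_surjective (c : ℕ) :
    Function.Surjective (toJohnsonOutQuotient A c) :=
  (QuotientGroup.mk'_surjective _).comp (MonoidHom.subgroupMap_surjective _ _)

theorem toJohnsonOutQuotient_eq_one_iff {c : ℕ} (φ : johnsonAut A c) :
    toJohnsonOutQuotient A c φ = 1 ↔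
      ∃ ψ ∈ johnsonAut A (c + 1), ∃ g, (φ : MulAut A) = ψ * MulAut.conj g := by
  refine (QuotientGroup.eq_one_iff _).trans ?_
  constructor
  · rintro ⟨ψ, hψ, h⟩
    obtain ⟨g, hg⟩ := QuotientGroup.eq.mp h
    exact ⟨ψ, hψ, g, by rw [hg, mul_inv_cancel_left]⟩
  · rintro ⟨ψ, hψ, g, h⟩
    refine ⟨ψ, hψ, QuotientGroup.eq.mpr ⟨g, ?_⟩⟩
    rw [h, inv_mul_cancel_left]

theorem fg_of_subgroup_multiplicative {M : Type*} [AddCommGroup M] [Module.Finite ℤ M]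
    (H : Subgroup (Multiplicative M)) : Group.FG H := by
  have : Module.Finite ℤ (Additive (Multiplicative M)) :=
    Module.Finite.of_surjective (AddEquiv.additiveMultiplicative M).symm.toIntLinearEquiv.toLinearMap
      (AddEquiv.additiveMultiplicative M).symm.surjective
  rw [Group.fg_iff_subgroup_fg, Subgroup.fg_iff_add_fg,
    ← AddSubgroup.toIntSubmodule_toAddSubgroup (Subgroup.toAddSubgroup H),
    ← Submodule.fg_iff_addSubgroup_fg]
  exact IsNoetherian.noetherian _

theorem isFreeAbelian_of_fg {Q : Type*} [Group Q] [Group.FG Q] (hcomm : ∀ a b : Q, a * b = b * a)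
    (hprime : ∀ p : ℕ, p.Prime → ∀ a : Q, a ^ p = 1 → a = 1) : IsFreeAbelian Q := by
  let _ : CommGroup Q := { (inferInstance : Group Q) with mul_comm := hcomm }
  have hn : ∀ n : ℕ, n ≠ 0 → ∀ a : Q, a ^ n = 1 → a = 1 := by
    intro n
    induction n using Nat.recOnMul with
    | zero => simp
    | one => simp
    | prime p hp => exact fun _ => hprime p hp
    | mul r s hr hs =>
      intro h a ha
      rw [pow_mul] at ha
      exact hr (left_ne_zero_of_mul h) a (hs (right_ne_zero_of_mul h) _ ha)
  have : IsMulTorsionFree Q := ⟨fun n h a b hab => by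
    have h1 : (a / b) ^ n = 1 := by rw [div_pow, div_eq_one]; exact hab
    exact div_eq_one.mp (hn n h _ h1)⟩
  have : Module.Finite ℤ (Additive Q) := Module.Finite.iff_addGroup_fg.mpr inferInstance
  have : Module.Free ℤ (Additive Q) := inferInstance
  let b := Module.Free.chooseBasis ℤ (Additive Q)
  exact ⟨_, ⟨AddEquiv.toMultiplicativeRight
    (b.repr.toAddEquiv.trans (FreeAbelianGroup.equivFinsupp _).symm)⟩⟩

end General

variable {V : Type*} {Γ : SimpleGraph V}

theorem mem_johnsonAut_of_generators {c : ℕ} {φ : MulAut (RAAG Γ)}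
    (h : ∀ v, (PresentedGroup.of v)⁻¹ * φ (PresentedGroup.of v) ∈ lcs (RAAG Γ) c) :
    φ ∈ johnsonAut (RAAG Γ) c := by
  rw [mem_johnsonAut_iff]
  apply raag_induction
  · exact h
  · simp [one_mem]
  · exact fun x y hx hy => map_mul_mem φ hx hy
  · exact fun x hx => map_inv_mem φ hx

variable (Γ) in
/-- The Johnson homomorphism on `G_{d+1}`: it records the classes of `v⁻¹ φ(v)` in degree `d + 1` of
the graded Lie ring, for all vertices `v`. -/
def johnsonHom (d : ℕ) :
    johnsonAut (RAAG Γ) (d + 1) →* Multiplicative (V → (graded (RAAG Γ)).Gr (d + 1)) :=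
  MonoidHom.mk' (fun φ => Multiplicative.ofAdd fun v => (graded (RAAG Γ)).cls (d + 1)
      ((PresentedGroup.of v)⁻¹ * φ.1 (PresentedGroup.of v)) (mem_johnsonAut_iff.mp φ.2 _)) (by
    intro φ ψ
    refine congrArg Multiplicative.ofAdd (funext fun v => ?_)
    have h1 := mem_johnsonAut_iff.mp φ.2 (PresentedGroup.of v)
    have h2 := mem_johnsonAut_iff.mp ψ.2 (PresentedGroup.of v)
    have h3 := inv_mul_map_mem_of_mem_johnsonAut_one (johnsonAut_mono (by omega) φ.2) _ _ h2
    have h4 : φ.1 ((PresentedGroup.of v)⁻¹ * ψ.1 (PresentedGroup.of v)) ∈ lcs (RAAG Γ) (d + 1) := by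
      have h := mul_mem h2 (lcs_anti (Nat.le_succ _) h3)
      rwa [mul_inv_cancel_left] at h
    have h5 : (graded (RAAG Γ)).cls (d + 1) _ h2 = (graded (RAAG Γ)).cls (d + 1) _ h4 :=
      cls_eq_iff.mpr h3
    change _ = (graded (RAAG Γ)).cls (d + 1) _ h1 + (graded (RAAG Γ)).cls (d + 1) _ h2
    rw [h5, ← cls_mul]
    exact cls_congr (by simp [mul_assoc]))

theorem toJohnsonOutQuotient_eq_one_of_johnsonHom {d : ℕ} {φ : johnsonAut (RAAG Γ) (d + 1)}
    (h : johnsonHom Γ d φ = 1) : toJohnsonOutQuotient (RAAG Γ) (d + 1) φ = 1 := by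
  rw [toJohnsonOutQuotient_eq_one_iff]
  refine ⟨φ, mem_johnsonAut_of_generators fun v => ?_, 1, by simp⟩
  exact cls_eq_zero_iff.mp (congrFun (congrArg Multiplicative.toAdd h) v)

theorem johnsonHom_conj {d : ℕ} {g : RAAG Γ} (hg : g ∈ lcs (RAAG Γ) d) (v : V) :
    (johnsonHom Γ d ⟨MulAut.conj g, conj_mem_johnsonAut hg⟩).toAdd v =
      (graded (RAAG Γ)).lieHom d 0 ((graded (RAAG Γ)).cls d g hg)
        ((graded (RAAG Γ)).cls 0 (PresentedGroup.of v) (Subgroup.mem_top _)) := by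
  have h : ⁅g, PresentedGroup.of v⁆ ∈ lcs (RAAG Γ) (d + 1) :=
    Subgroup.commutator_mem_commutator hg (Subgroup.mem_top _)
  have e : (graded (RAAG Γ)).lieHom d 0 ((graded (RAAG Γ)).cls d g hg)
      ((graded (RAAG Γ)).cls 0 (PresentedGroup.of v) (Subgroup.mem_top _)) =
      (graded (RAAG Γ)).cls (d + 1) ⁅g, PresentedGroup.of v⁆ h :=
    lieHom_cls _ hg (Subgroup.mem_top _)
  rw [e, ← cls_conj (PresentedGroup.of v)⁻¹ h
    (hx' := (inferInstance : (lcs (RAAG Γ) (d + 1)).Normal).conj_mem _ h _)]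
  exact cls_congr (by simp [commutatorElement_def, mul_assoc])

/-- By induction, the centre of the graded Lie ring being trivial in each degree below `d`. -/
theorem mem_lcs_of_conj_mem_johnsonAut [Finite V] (hΓ : ∀ v, ∃ u, u ≠ v ∧ ¬ Γ.Adj u v) {d : ℕ}
    {g : RAAG Γ} (hg : MulAut.conj g ∈ johnsonAut (RAAG Γ) (d + 1)) : g ∈ lcs (RAAG Γ) d := by
  suffices h : ∀ i ≤ d, g ∈ lcs (RAAG Γ) i from h d le_rfl
  intro i
  induction i with
  | zero => exact fun _ => Subgroup.mem_top g
  | succ i ih =>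
    intro hi
    refine mem_lcs_succ_of_commutator hΓ (ih (by omega)) fun v => ?_
    have h1 := (inferInstance : (lcs (RAAG Γ) _).Normal).conj_mem _
      (mem_johnsonAut_iff.mp hg (PresentedGroup.of v)) (PresentedGroup.of v)
    refine lcs_anti (show i + 2 ≤ d + 1 by omega) ?_
    simpa [commutatorElement_def, mul_assoc] using h1

theorem graded_eq_zero_of_nsmul [Finite V] {n p : ℕ} (hp : p ≠ 0) {a : (graded (RAAG Γ)).Gr n}
    (h : p • a = 0) : a = 0 := by
  obtain ⟨x, hx, rfl⟩ := cls_surjective a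
  rw [← cls_pow, cls_eq_zero_iff] at h
  exact cls_eq_zero_iff.mpr (mem_lcs_succ_of_pow hp hx h)

/-- The quotient `H_{d+1} / H_{d+2}` has no `p`-torsion. -/
theorem eq_one_of_pow_eq_one [Finite V] (hΓ : ∀ v, ∃ u, u ≠ v ∧ ¬ Γ.Adj u v) {d p : ℕ}
    (hp : p.Prime) (a : JohnsonOutQuotient (RAAG Γ) (d + 1)) (ha : a ^ p = 1) : a = 1 := by
  have : Fact p.Prime := ⟨hp⟩
  obtain ⟨φ, rfl⟩ := toJohnsonOutQuotient_surjective _ a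
  rw [← map_pow, toJohnsonOutQuotient_eq_one_iff] at ha
  obtain ⟨ψ, hψ, g, hg⟩ := ha
  have hψ' : ψ ∈ johnsonAut (RAAG Γ) (d + 1) := johnsonAut_mono (Nat.le_succ _) hψ
  have hconj : MulAut.conj g ∈ johnsonAut (RAAG Γ) (d + 1) := by
    have h1 : MulAut.conj g = ψ⁻¹ * (φ ^ p : johnsonAut (RAAG Γ) (d + 1)).1 := by
      rw [hg, inv_mul_cancel_left]
    rw [h1]
    exact mul_mem (inv_mem hψ') (φ ^ p).2
  have hgd := mem_lcs_of_conj_mem_johnsonAut hΓ hconj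
  let T := johnsonHom Γ d
  let L := (graded (RAAG Γ)).lieHom d 0
  let e : V → (graded (RAAG Γ)).Gr 0 := fun v =>
    (graded (RAAG Γ)).cls 0 (PresentedGroup.of v) (Subgroup.mem_top _)
  have hT : ∀ v, p • (T φ).toAdd v = L ((graded (RAAG Γ)).cls d g hgd) (e v) := by
    intro v
    have h1 : φ ^ p = ⟨ψ, hψ'⟩ * ⟨MulAut.conj g, hconj⟩ := Subtype.ext hg
    have h2 : T ⟨ψ, hψ'⟩ = 1 := congrArg Multiplicative.ofAdd
      (funext fun v => cls_eq_zero_iff.mpr (mem_johnsonAut_iff.mp hψ _))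
    have h3 := congrArg T h1
    rw [map_pow, map_mul, h2, one_mul] at h3
    exact (congrFun (congrArg Multiplicative.toAdd h3) v).trans (johnsonHom_conj hgd v)
  -- `[g, v]` is a `p`-th power modulo the next term for every vertex, hence so is `g`
  obtain ⟨h, hh, hhg⟩ := exists_pow_of_commutator (p := p) hΓ hgd fun v =>
    ⟨_, mem_johnsonAut_iff.mp φ.2 (PresentedGroup.of v), cls_eq_iff.mp
      ((cls_pow _ p).trans ((hT v).trans (lieHom_cls _ hgd (Subgroup.mem_top _))))⟩
  have hcls : p • (graded (RAAG Γ)).cls d h hh = (graded (RAAG Γ)).cls d g hgd :=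
    (cls_pow hh p).symm.trans (cls_eq_iff.mpr hhg)
  let κ : johnsonAut (RAAG Γ) (d + 1) := ⟨MulAut.conj h, conj_mem_johnsonAut hh⟩
  -- `p T(φ) = p T(κ)` and the target of `T` is torsion-free
  have hTκ : T φ = T κ := by
    refine congrArg Multiplicative.ofAdd (funext fun v => ?_ : (T φ).toAdd = (T κ).toAdd)
    rw [← sub_eq_zero]
    refine graded_eq_zero_of_nsmul hp.ne_zero ?_
    rw [smul_sub, hT, ← hcls, map_nsmul, AddMonoidHom.nsmul_apply, sub_eq_zero]
    exact congrArg (p • ·) (johnsonHom_conj hh v).symm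
  have h1 : toJohnsonOutQuotient (RAAG Γ) (d + 1) (φ * κ⁻¹) = 1 :=
    toJohnsonOutQuotient_eq_one_of_johnsonHom (by
      rw [map_mul, map_inv, mul_inv_eq_one]
      exact hTκ)
  have h2 : toJohnsonOutQuotient (RAAG Γ) (d + 1) κ = 1 :=
    (toJohnsonOutQuotient_eq_one_iff κ).mpr ⟨1, one_mem _, h, (one_mul _).symm⟩
  rwa [map_mul, map_inv, h2, inv_one, mul_one] at h1

theorem exists_surjective_johnsonHom_range (d : ℕ) :
    ∃ f : (johnsonHom Γ d).range →* JohnsonOutQuotient (RAAG Γ) (d + 1),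
      Function.Surjective f := by
  let e := QuotientGroup.quotientKerEquivRange (johnsonHom Γ d)
  let q := QuotientGroup.lift (johnsonHom Γ d).ker (toJohnsonOutQuotient (RAAG Γ) (d + 1))
    fun φ hφ => toJohnsonOutQuotient_eq_one_of_johnsonHom hφ
  have hq : Function.Surjective q :=
    QuotientGroup.lift_surjective_of_surjective _ _ (toJohnsonOutQuotient_surjective _) _
  exact ⟨q.comp e.symm.toMonoidHom, hq.comp e.symm.surjective⟩

end Johnson

theorem mainTheorem6 {V : Type*} [Finite V] (Γ : SimpleGraph V)
    (hZ : Subgroup.center (RAAG Γ) = ⊥) (c : ℕ) (hc : 1 ≤ c) :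
    IsFreeAbelian (JohnsonOutQuotient (RAAG Γ) c) := by
  obtain ⟨d, rfl⟩ : ∃ d, c = d + 1 := ⟨c - 1, by omega⟩
  obtain ⟨f, hf⟩ := exists_surjective_johnsonHom_range (Γ := Γ) d
  have := Fintype.ofFinite V
  have := fg_of_subgroup_multiplicative (johnsonHom Γ d).range
  have : Group.FG (JohnsonOutQuotient (RAAG Γ) (d + 1)) := Group.fg_of_surjective hf
  refine isFreeAbelian_of_fg (fun a b => ?_)
    fun p hp => eq_one_of_pow_eq_one (exists_not_adj hZ) hp
  obtain ⟨x, rfl⟩ := hf a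
  obtain ⟨y, rfl⟩ := hf b
  rw [← map_mul, ← map_mul, mul_comm]
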